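/- Let $(\Omega,\mathcal F,\mathbb P,(\mathcal F_t)_{t\ge 0})$ be a filtered probability space. An $\mathbb R^n$-valued process $Z=(Z_t)_{t\ge0}$ is called a Lévy process (with respect to $(\mathcal F_t)$) if (a) $Z$ is adapted to $(\mathcal F_t)$; (b) $Z_0=0$ a.s.; (c) for all $s,t\ge 0$, $Z_{t+s}-Z_t$ is independent of $\mathcal F_t$ and has the same law as $Z_s$; (d) $Z$ is continuous in probability. Let $X$ be an $\mathbb R^n$-valued Lévy process all of whose paths are càdlàg. For a Borel set $B\subseteq\mathbb R^n$ with $0\notin\overline B$ let $$S^1_B:=\inf\{t>0: X_t-X_{t-}\in B\},\qquad S^{k+1}_B:=\inf\{t>S^k_B: X_t-X_{t-}\in B\}\quad(k\ge 1),$$ with $\inf\varnothing=\infty$, and let the associated jump process be $$X_t(B):=\sum_{k\ge 1}\bigl(X_{S^k_B}-X_{S^k_B-}\bigr)\,\mathbf 1_{\{S^k_B\le t\}},\qquad t\ge 0,$$ which is a sum with only finitely many nonzero terms. If $B_1,B_2\subseteq\mathbb R^n$ are disjoint Borel sets with $0\notin\overline{B_1}\cup\overline{B_2}$, then $(X_t(B_1))_{t\ge0}$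 and $(X_t(B_2))_{t\ge0}$ are Lévy processes with respect to $(\mathcal F_t)$, and these two processes are independent of each other (that is, the $\sigma$-algebras $\sigma(X_t(B_1):t\ge0)$ and $\sigma(X_t(B_2):t\ge0)$ are independent). -/

import Mathlib

open MeasureTheory ProbabilityTheory Filter Topology
open scoped NNReal ENNReal

namespace JumpProcesses

variable {Ω : Type*} {mΩ : MeasurableSpace Ω} {n : ℕ}

/-- `X` is an `n`-dimensional Lévy process on the filtered probability space `(Ω, mΩ, P, F)`.
No regularity of the paths is part of this definition. -/
structure IsLevyProcess (F : Filtration ℝ≥0 mΩ) (P : Measure Ω)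
    (X : ℝ≥0 → Ω → EuclideanSpace ℝ (Fin n)) : Prop where
  /-- `X` is adapted to the filtration. -/
  adapted : Adapted F X
  /-- `X` starts at the origin almost surely. -/
  zero : ∀ᵐ ω ∂P, X 0 ω = 0
  /-- The increments after time `t` are independent of `F t`. -/
  indep_increment : ∀ t s : ℝ≥0,
    Indep (MeasurableSpace.comap (fun ω => X (t + s) ω - X t ω) inferInstance) (F t) P
  /-- The increment over `[t, t + s]` has the law of `X s`. -/
  identDistrib_increment : ∀ t s : ℝ≥0,
    IdentDistrib (fun ω => X (t + s) ω - X t ω) (X s) P P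
  /-- `X` is continuous in probability. -/
  continuous_in_probability : ∀ t : ℝ≥0, TendstoInMeasure P X (𝓝 t) (X t)

/-- The path `f` is right-continuous with left limits (at `0` the second condition is void). -/
def IsCadlag (f : ℝ≥0 → EuclideanSpace ℝ (Fin n)) : Prop :=
  ∀ t : ℝ≥0, ContinuousWithinAt f (Set.Ici t) t ∧ ∃ l, Tendsto f (𝓝[<] t) (𝓝 l)

/-- The jump `f t - f (t-)` of the path `f` at time `t`. -/
noncomputable def jump (f : ℝ≥0 → EuclideanSpace ℝ (Fin n)) (t : ℝ≥0) :
    EuclideanSpace ℝ (Fin n) :=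
  f t - Function.leftLim f t

/-- The successive times at which the path `f` makes a jump in `B`: starting from time `0` (which
is not itself a jump time), the `(k + 1)`-st one is the infimum in `[0, ∞]` of the times `t` after
the `k`-th one with `f t - f (t-) ∈ B`, and `∞` if there are none. -/
noncomputable def jumpTime (f : ℝ≥0 → EuclideanSpace ℝ (Fin n))
    (B : Set (EuclideanSpace ℝ (Fin n))) : ℕ → ℝ≥0∞
  | 0 => 0
  | k + 1 => sInf ((fun t : ℝ≥0 => (t : ℝ≥0∞)) ''
      {t : ℝ≥0 | jumpTime f B k < (t : ℝ≥0∞) ∧ jump f t ∈ B})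

open scoped Classical in
/-- The jump process `X(B)`: the sum, over the successive times up to `t` at which `X` jumps in
`B`, of the corresponding jumps of `X`. For càdlàg paths and `0 ∉ closure B` there are only
finitely many nonzero terms. -/
noncomputable def jumpProcess (X : ℝ≥0 → Ω → EuclideanSpace ℝ (Fin n))
    (B : Set (EuclideanSpace ℝ (Fin n))) (t : ℝ≥0) (ω : Ω) : EuclideanSpace ℝ (Fin n) :=
  ∑' k : ℕ, if jumpTime (fun s => X s ω) B (k + 1) ≤ (t : ℝ≥0∞)
    then jump (fun s => X s ω) (jumpTime (fun s => X s ω) B (k + 1)).toNNReal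
    else 0

end JumpProcesses

/-! Since `0 ∉ closure B`, the points of `B` have norm bounded below, so a càdlàg path has only
finitely many jumps in `B` on each `(0, t]`. The jump times enumerate them, and `X_t(B)` is the sum
of `B.indicator id` over the jumps (`jumpProcess_eq_jumpSum`). For continuous `h` vanishing near
`0`, the sum of `h` over the jumps is the limit of sums of `h` over the increments of `X` on finer
and finer grids (`IsCadlag.tendsto_sum_increments`). This gives measurability, and later turns
expectations into powers.

Lévy property: the whole path of increments after `t` is independent of `F t` and its law does not
depend on `t`. The increment of a jump sum after `t` is a fixed measurable functional of that path,
so it inherits both properties.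

Independence: because the increments of the pair are independent of the past and stationary, it
suffices to treat one fixed time (`indepFun_of_indep_increments`,
`IsLevyProcess.indepFun_jumpSum_of_forall`). There one factorizes the expectation of `exp` of two
jump sums. Take continuous `k₁`, `k₂` of nonpositive real part, vanishing near `0`, at each point
one of them zero. With `m + 1` cells, let `a`, `b` be the expectations of `exp (k₁ Y)`, `exp (k₂ Y)`
for one increment `Y`. Then `exp (k₁ + k₂) = exp k₁ + exp k₂ - 1`, so the joint expectation is `a +
b - 1 = a * b - (1 - a) * (1 - b)`. Both `1 - a` and `1 - b` are `O(1/m)`, since a large increment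
in one cell has probability of that order. Hence the `(m + 1)`-st powers of `a + b - 1` and `a * b`
differ by `O(1/m)`, and in the limit the expectation factorizes
(`IsLevyProcess.integral_exp_jumpSum_of_continuous`). Thickened indicators pass to disjoint compact
sets, and inner regularity to disjoint Borel sets. Exponents `i⟨x, u⟩` then give characteristic
functions. -/

namespace JumpProcesses

/-! ### Càdlàg paths: finitely many big jumps, and jump sums as limits along grids. -/

section Paths

variable {n : ℕ} {f : ℝ≥0 → EuclideanSpace ℝ (Fin n)}

/-- The times in `(0, t]` at which `f` has a jump of size at least `ε`. -/
def bigJumps (f : ℝ≥0 → EuclideanSpace ℝ (Fin n)) (ε : ℝ) (t : ℝ≥0) : Set ℝ≥0 :=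
  {s | s ∈ Set.Ioc 0 t ∧ ε ≤ ‖jump f s‖}

/-- The sum of `h` over the jumps of `f` of size at least `ε` up to time `t`. -/
noncomputable def jumpSum {G : Type*} [AddCommMonoid G] (h : EuclideanSpace ℝ (Fin n) → G)
    (ε : ℝ) (f : ℝ≥0 → EuclideanSpace ℝ (Fin n)) (t : ℝ≥0) : G :=
  ∑ᶠ s ∈ bigJumps f ε t, h (jump f s)

theorem nhdsLT_neBot {s : ℝ≥0} (hs : 0 < s) : (𝓝[<] s).NeBot :=
  nhdsLT_neBot_of_exists_lt ⟨0, hs⟩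

theorem IsCadlag.tendsto_leftLim (hf : IsCadlag f) (s : ℝ≥0) :
    Tendsto f (𝓝[<] s) (𝓝 (Function.leftLim f s)) :=
  tendsto_leftLim_of_tendsto (hf s).2

theorem IsCadlag.tendsto_jump (hf : IsCadlag f) (s : ℝ≥0) :
    Tendsto (fun u => f s - f u) (𝓝[<] s) (𝓝 (jump f s)) :=
  tendsto_const_nhds.sub (hf.tendsto_leftLim s)

/-- Near `s` the path stays within `ε / 2` of its left limit before `s`, and within `ε / 2` of `f s`
from `s` on. Only a pair of times straddling `s` can see more. -/
theorem IsCadlag.exists_nhds_modulus (hf : IsCadlag f) (s : ℝ≥0) {ε : ℝ} (hε : 0 < ε) :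
    ∃ U : Set ℝ≥0, IsOpen U ∧ s ∈ U ∧
      ∀ u ∈ U, ∀ v ∈ U, u ≤ v → ¬ (u < s ∧ s ≤ v) → ‖f v - f u‖ < ε := by
  obtain ⟨hr, l, hl⟩ := hf s
  have h1 : ∀ᶠ x in 𝓝[≥] s, dist (f x) (f s) < ε / 2 :=
    hr.eventually (Metric.ball_mem_nhds _ (half_pos hε))
  have h2 : ∀ᶠ x in 𝓝[<] s, dist (f x) l < ε / 2 :=
    hl.eventually (Metric.ball_mem_nhds _ (half_pos hε))
  rw [eventually_nhdsWithin_iff] at h1 h2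
  obtain ⟨U, hU, hUo, hsU⟩ := eventually_nhds_iff.1 (h1.and h2)
  refine ⟨U, hUo, hsU, fun u hu v hv huv hs => ?_⟩
  rw [← dist_eq_norm]
  rcases lt_or_ge u s with hus | hus
  · have hvs : v < s := by
      by_contra! h
      exact hs ⟨hus, h⟩
    calc dist (f v) (f u) ≤ dist (f v) l + dist (f u) l := dist_triangle_right _ _ _
      _ < ε := by linarith [(hU u hu).2 hus, (hU v hv).2 hvs]
  · calc dist (f v) (f u) ≤ dist (f v) (f s) + dist (f u) (f s) := dist_triangle_right _ _ _
      _ < ε := by linarith [(hU u hu).1 hus, (hU v hv).1 (hus.trans huv)]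

/-- Away from finitely many times, a càdlàg path oscillates by less than `ε` on short intervals. -/
theorem IsCadlag.exists_modulus (hf : IsCadlag f) (t : ℝ≥0) {ε : ℝ} (hε : 0 < ε) :
    ∃ T : Finset ℝ≥0, ∃ δ > 0, (∀ s ∈ T, s ∈ Set.Ioc 0 t) ∧
      (∀ u v, u ≤ v → v ≤ t → dist v u < δ → (∀ s ∈ T, ¬ (u < s ∧ s ≤ v)) → ‖f v - f u‖ < ε) := by
  classical
  choose U hUo hsU hU using fun s => hf.exists_nhds_modulus s hε
  obtain ⟨T, -, hT⟩ := (isCompact_Icc (a := (0 : ℝ≥0)) (b := t)).elim_nhds_subcover U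
    fun s _ => (hUo s).mem_nhds (hsU s)
  -- Two times closer than the Lebesgue number lie in a common `U i`, so the centre `i` is the only
  -- point they must not straddle.
  obtain ⟨δ, hδ, hLeb⟩ := lebesgue_number_lemma_of_metric
    (isCompact_Icc (a := (0 : ℝ≥0)) (b := t)) (c := fun i : T => U i) (fun i => hUo i)
    (by simpa [Set.iUnion_subtype] using hT)
  refine ⟨T.filter (· ∈ Set.Ioc 0 t), δ, hδ, fun s hs => (Finset.mem_filter.1 hs).2,
    fun u v huv hvt hd hs => ?_⟩
  obtain ⟨i, hi⟩ := hLeb u ⟨zero_le, huv.trans hvt⟩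
  refine hU i u (hi (Metric.mem_ball_self hδ)) v (hi hd) huv fun h => ?_
  exact hs i (Finset.mem_filter.2 ⟨i.2, pos_of_gt h.1, h.2.trans hvt⟩) h

/-- A jump at `s ∉ T` is the limit of `f s - f u` as `u` increases to `s`, all of norm below `ε'`.
The limit only keeps `≤ ε'`, whence the strict gap `ε' < ε`. -/
theorem bigJumps_subset_of_modulus (hf : IsCadlag f) {t : ℝ≥0} {ε ε' : ℝ} (hε : ε' < ε)
    {T : Finset ℝ≥0} {δ : ℝ} (hδ : 0 < δ)
    (hT : ∀ u v, u ≤ v → v ≤ t → dist v u < δ → (∀ s ∈ T, ¬ (u < s ∧ s ≤ v)) → ‖f v - f u‖ < ε') :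
    bigJumps f ε t ⊆ T := by
  rintro s ⟨⟨hs0, hst⟩, hs⟩
  by_contra hsT
  have := nhdsLT_neBot hs0
  refine absurd hs (not_le.2 (lt_of_le_of_lt ?_ hε))
  refine le_of_tendsto (hf.tendsto_jump s).norm ?_
  have h1 : ∀ᶠ u in 𝓝[<] s, dist s u < δ := by
    refine nhdsWithin_le_nhds ?_
    filter_upwards [Metric.ball_mem_nhds s hδ] with u hu
    rw [dist_comm]
    exact hu
  have h2 : ∀ᶠ u in 𝓝[<] s, ∀ r ∈ T, ¬ (u < r ∧ r ≤ s) := by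
    rw [Filter.eventually_all_finset]
    intro r hr
    rcases lt_or_ge r s with h | h
    · filter_upwards [nhdsWithin_le_nhds (lt_mem_nhds h)] with u hu
      exact fun h' => absurd h'.1 (not_lt.2 (le_of_lt hu))
    · refine Eventually.of_forall fun u h' => hsT ?_
      rw [le_antisymm h h'.2]
      exact hr
  filter_upwards [h1, h2, self_mem_nhdsWithin] with u hu1 hu2 hu3
  exact (hT u s (le_of_lt hu3) hst hu1 hu2).le

theorem IsCadlag.finite_bigJumps (hf : IsCadlag f) {ε : ℝ} (hε : 0 < ε) (t : ℝ≥0) :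
    (bigJumps f ε t).Finite := by
  obtain ⟨T, δ, hδ, -, hT⟩ := hf.exists_modulus t (half_pos hε)
  exact T.finite_toSet.subset (bigJumps_subset_of_modulus hf (half_lt_self hε) hδ hT)

theorem IsCadlag.jumpSum_eq_sum (hf : IsCadlag f) {ε : ℝ} (hε : 0 < ε) (t : ℝ≥0) {G : Type*}
    [AddCommMonoid G] (h : EuclideanSpace ℝ (Fin n) → G) :
    jumpSum h ε f t = ∑ s ∈ (hf.finite_bigJumps hε t).toFinset, h (jump f s) :=
  finsum_mem_eq_finite_toFinset_sum _ _

theorem IsCadlag.jumpSum_eq_sum_of_subset (hf : IsCadlag f) {ε : ℝ} (hε : 0 < ε) {t : ℝ≥0}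
    {G : Type*} [AddCommMonoid G] {h : EuclideanSpace ℝ (Fin n) → G}
    (h0 : ∀ x, ‖x‖ < ε → h x = 0) {T : Finset ℝ≥0} (hT : ∀ s ∈ T, s ∈ Set.Ioc 0 t)
    (hsub : bigJumps f ε t ⊆ T) :
    jumpSum h ε f t = ∑ s ∈ T, h (jump f s) := by
  rw [hf.jumpSum_eq_sum hε]
  refine Finset.sum_subset (by simpa using hsub) fun s hs hs' => h0 _ ?_
  by_contra! hlt
  exact hs' ((Set.Finite.mem_toFinset _).2 ⟨hT s hs, hlt⟩)

/-- The sum over the jumps does not depend on the truncation level. -/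
theorem IsCadlag.jumpSum_congr_level (hf : IsCadlag f) {ε ε' : ℝ} (hε : 0 < ε) (hε' : 0 < ε')
    (t : ℝ≥0) {G : Type*} [AddCommMonoid G] {h : EuclideanSpace ℝ (Fin n) → G}
    (h0 : ∀ x, ‖x‖ < ε → h x = 0) (h0' : ∀ x, ‖x‖ < ε' → h x = 0) :
    jumpSum h ε f t = jumpSum h ε' f t := by
  classical
  rw [hf.jumpSum_eq_sum_of_subset hε h0
    (T := (hf.finite_bigJumps hε t).toFinset ∪ (hf.finite_bigJumps hε' t).toFinset),
    hf.jumpSum_eq_sum_of_subset hε' h0'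
    (T := (hf.finite_bigJumps hε t).toFinset ∪ (hf.finite_bigJumps hε' t).toFinset)]
  · rintro s hs
    rcases Finset.mem_union.1 hs with h | h <;> exact ((Set.Finite.mem_toFinset _).1 h).1
  · simp
  · rintro s hs
    rcases Finset.mem_union.1 hs with h | h <;> exact ((Set.Finite.mem_toFinset _).1 h).1
  · simp

/-- The `i`-th point of the partition of `[0, t]` into `m + 1` intervals of the same length. -/
noncomputable def grid (t : ℝ≥0) (m i : ℕ) : ℝ≥0 := i * (t / (m + 1))

theorem grid_zero (t : ℝ≥0) (m : ℕ) : grid t m 0 = 0 := by simp [grid]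

theorem grid_succ (t : ℝ≥0) (m i : ℕ) : grid t m (i + 1) = grid t m i + t / (m + 1) := by
  simp [grid, add_mul]

theorem grid_last (t : ℝ≥0) (m : ℕ) : grid t m (m + 1) = t := by
  have : ((m : ℝ≥0) + 1) ≠ 0 := by positivity
  simp only [grid, Nat.cast_add, Nat.cast_one]
  field_simp

theorem grid_mono (t : ℝ≥0) (m : ℕ) : Monotone (grid t m) := fun i j hij => by
  unfold grid
  gcongr

theorem exists_grid_lt_le {s t : ℝ≥0} (hs : s ∈ Set.Ioc 0 t) (m : ℕ) :
    ∃ i < m + 1, grid t m i < s ∧ s ≤ grid t m (i + 1) := by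
  have hex : ∃ j, s ≤ grid t m j := ⟨m + 1, by rw [grid_last]; exact hs.2⟩
  classical
  have hspec := Nat.find_spec hex
  have hle : Nat.find hex ≤ m + 1 := Nat.find_min' hex (by rw [grid_last]; exact hs.2)
  have hmin := fun k => Nat.find_min hex (m := k)
  generalize Nat.find hex = j at *
  rcases j with _ | j
  · rw [grid_zero] at hspec
    exact absurd hspec (not_le.2 hs.1)
  · exact ⟨j, hle, not_le.1 (hmin j (Nat.lt_succ_self j)), hspec⟩

theorem tendsto_mesh (t : ℝ≥0) : Tendsto (fun m : ℕ => t / ((m : ℝ≥0) + 1)) atTop (𝓝 0) := by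
  rw [← NNReal.tendsto_coe]
  push_cast
  exact tendsto_const_div_atTop_nhds_zero_nat (t : ℝ) |>.comp (tendsto_add_atTop_nat 1) |>.congr
    fun m => by simp

/-- Sums of a function that vanishes near `0` over the increments of a càdlàg path converge to the
sum of that function over the jumps. -/
theorem IsCadlag.tendsto_sum_increments (hf : IsCadlag f) {ε : ℝ} (hε : 0 < ε) (t : ℝ≥0)
    {G : Type*} [AddCommMonoid G] [TopologicalSpace G] [ContinuousAdd G]
    {h : EuclideanSpace ℝ (Fin n) → G} (hc : Continuous h) (h0 : ∀ x, ‖x‖ < ε → h x = 0) :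
    Tendsto (fun m => ∑ i ∈ Finset.range (m + 1), h (f (grid t m (i + 1)) - f (grid t m i)))
      atTop (𝓝 (jumpSum h ε f t)) := by
  classical
  obtain ⟨T, δ, hδ, hTt, hT⟩ := hf.exists_modulus t (half_pos hε)
  rw [hf.jumpSum_eq_sum_of_subset hε h0 hTt
    (bigJumps_subset_of_modulus hf (half_lt_self hε) hδ hT)]
  -- The index of the cell containing `s`; outside `(0, t]` the value `0` is a dummy that makes `ι`
  -- total.
  have hex : ∀ m s, ∃ i, s ∈ Set.Ioc 0 t → i < m + 1 ∧ grid t m i < s ∧ s ≤ grid t m (i + 1) := by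
    intro m s
    by_cases hs : s ∈ Set.Ioc 0 t
    · obtain ⟨i, hi⟩ := exists_grid_lt_le hs m
      exact ⟨i, fun _ => hi⟩
    · exact ⟨0, fun h => absurd h hs⟩
  choose ι hι using hex
  have hmesh : Tendsto (fun m : ℕ => ((t / ((m : ℝ≥0) + 1) : ℝ≥0) : ℝ)) atTop (𝓝 0) :=
    NNReal.tendsto_coe.2 (tendsto_mesh t)
  have hlim : Tendsto (fun m => ∑ s ∈ T,
      h (f (grid t m (ι m s + 1)) - f (grid t m (ι m s)))) atTop (𝓝 (∑ s ∈ T, h (jump f s))) := by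
    refine tendsto_finsetSum _ fun s hs => (hc.tendsto _).comp (Tendsto.sub ?_ ?_)
    · refine (hf s).1.tendsto.comp (tendsto_nhdsWithin_iff.2 ⟨?_, Eventually.of_forall fun m =>
        (hι m s (hTt s hs)).2.2⟩)
      refine tendsto_iff_dist_tendsto_zero.2
        (squeeze_zero (fun _ => dist_nonneg) (fun m => ?_) hmesh)
      have h1 := (hι m s (hTt s hs)).2.2
      have h2 : (grid t m (ι m s) : ℝ) < s := (hι m s (hTt s hs)).2.1
      have h3 : (s : ℝ) ≤ grid t m (ι m s + 1) := h1
      have h4 : (grid t m (ι m s + 1) : ℝ) = grid t m (ι m s) + (t / ((m : ℝ≥0) + 1) : ℝ≥0) := by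
        rw [grid_succ, NNReal.coe_add]
      rw [NNReal.dist_eq, abs_of_nonneg (by linarith)]
      linarith
    · refine (hf.tendsto_leftLim s).comp (tendsto_nhdsWithin_iff.2 ⟨?_,
        Eventually.of_forall fun m =>
        (hι m s (hTt s hs)).2.1⟩)
      refine tendsto_iff_dist_tendsto_zero.2
        (squeeze_zero (fun _ => dist_nonneg) (fun m => ?_) hmesh)
      have h1 := (hι m s (hTt s hs)).2.2
      have h2 : (grid t m (ι m s) : ℝ) < s := (hι m s (hTt s hs)).2.1
      have h3 : (s : ℝ) ≤ grid t m (ι m s + 1) := h1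
      have h4 : (grid t m (ι m s + 1) : ℝ) = grid t m (ι m s) + (t / ((m : ℝ≥0) + 1) : ℝ≥0) := by
        rw [grid_succ, NNReal.coe_add]
      rw [NNReal.dist_eq, abs_of_nonpos (by linarith)]
      linarith
  refine hlim.congr' ?_
  -- Once the mesh is smaller than the distances between points of `T`, no cell contains two of
  -- them.
  have hinj : ∀ᶠ m in atTop, ∀ s ∈ T, ∀ s' ∈ T, ι m s = ι m s' → s = s' := by
    rw [Filter.eventually_all_finset]
    intro s hs
    rw [Filter.eventually_all_finset]
    intro s' hs'
    by_cases hss : s = s'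
    · exact Eventually.of_forall fun _ _ => hss
    · filter_upwards [hmesh.eventually (gt_mem_nhds (dist_pos.2 hss))] with m hm heq
      have h1 := hι m s (hTt s hs)
      have h2 := hι m s' (hTt s' hs')
      rw [← heq, grid_succ] at h2
      rw [grid_succ] at h1
      have a1 : (grid t m (ι m s) : ℝ) < s := h1.2.1
      have a2 : (grid t m (ι m s) : ℝ) < s' := h2.2.1
      have a3 : (s : ℝ) ≤ grid t m (ι m s) + (t / ((m : ℝ≥0) + 1) : ℝ≥0) := h1.2.2
      have a4 : (s' : ℝ) ≤ grid t m (ι m s) + (t / ((m : ℝ≥0) + 1) : ℝ≥0) := h2.2.2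
      rw [NNReal.dist_eq] at hm
      exact absurd hm (not_lt.2 (abs_le.2 ⟨by linarith, by linarith⟩))
  filter_upwards [hinj, hmesh.eventually (gt_mem_nhds hδ)] with m hm hmδ
  rw [← Finset.sum_image (s := T) (g := ι m)
    (f := fun i => h (f (grid t m (i + 1)) - f (grid t m i))) (fun s hs s' hs' => hm s hs s' hs')]
  -- A cell containing no point of `T` has an increment of norm below `ε / 2`, where `h` vanishes.
  refine Finset.sum_subset (fun i hi => ?_) fun i hi hi' => h0 _ ?_
  · obtain ⟨s, hs, rfl⟩ := Finset.mem_image.1 hi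
    exact Finset.mem_range.2 (hι m s (hTt s hs)).1
  · refine (hT _ _ (grid_mono t m i.le_succ) ?_ ?_ fun s hs hlt => hi' ?_).trans (half_lt_self hε)
    · calc grid t m (i + 1) ≤ grid t m (m + 1) := grid_mono t m (Finset.mem_range.1 hi)
        _ = t := grid_last t m
    · rw [grid_succ, NNReal.dist_eq, NNReal.coe_add, add_sub_cancel_left,
        abs_of_nonneg (NNReal.coe_nonneg _)]
      exact hmδ
    · have h1 := hι m s (hTt s hs)
      refine Finset.mem_image.2 ⟨s, hs, le_antisymm ?_ ?_⟩
      · exact Nat.lt_succ_iff.1 ((grid_mono t m).reflect_lt (h1.2.1.trans_le hlt.2))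
      · exact Nat.lt_succ_iff.1 ((grid_mono t m).reflect_lt (hlt.1.trans_le h1.2.2))

end Paths

/-! ### Jump sums of the path shifted in time. -/

section Increments

variable {n : ℕ} {f : ℝ≥0 → EuclideanSpace ℝ (Fin n)}

/-- The path of the increments of `f` after time `t`. -/
def incrementPath (f : ℝ≥0 → EuclideanSpace ℝ (Fin n)) (t : ℝ≥0) :
    ℝ≥0 → EuclideanSpace ℝ (Fin n) :=
  fun r => f (t + r) - f t

theorem tendsto_add_left_nhdsLT (t r : ℝ≥0) : Tendsto (fun u => t + u) (𝓝[<] r) (𝓝[<] (t + r)) :=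
  tendsto_nhdsWithin_iff.2
    ⟨((continuous_const.add continuous_id).tendsto r).mono_left nhdsWithin_le_nhds,
      by filter_upwards [self_mem_nhdsWithin] with u hu using add_lt_add_right hu t⟩

theorem IsCadlag.incrementPath (hf : IsCadlag f) (t : ℝ≥0) :
    IsCadlag (JumpProcesses.incrementPath f t) := by
  intro r
  constructor
  · refine Tendsto.sub ((hf (t + r)).1.tendsto.comp (tendsto_nhdsWithin_iff.2 ⟨?_, ?_⟩))
      tendsto_const_nhds
    · exact ((continuous_const.add continuous_id).tendsto r).mono_left nhdsWithin_le_nhds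
    · filter_upwards [self_mem_nhdsWithin] with u hu using add_le_add_right hu t
  · obtain ⟨l, hl⟩ := (hf (t + r)).2
    exact ⟨l - f t, (hl.comp (tendsto_add_left_nhdsLT t r)).sub tendsto_const_nhds⟩

/-- The case `r = 0` must be excluded: `𝓝[<] 0` is trivial, so the shifted path has jump zero there
even if `f` jumps at `t`. -/
theorem IsCadlag.jump_incrementPath (hf : IsCadlag f) (t : ℝ≥0) {r : ℝ≥0} (hr : 0 < r) :
    jump (JumpProcesses.incrementPath f t) r = jump f (t + r) := by
  have := nhdsLT_neBot hr
  refine tendsto_nhds_unique ((hf.incrementPath t).tendsto_jump r) ?_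
  refine ((hf.tendsto_jump (t + r)).comp (tendsto_add_left_nhdsLT t r)).congr fun u => ?_
  simp [JumpProcesses.incrementPath]

theorem IsCadlag.bigJumps_add (hf : IsCadlag f) (ε : ℝ) (t s : ℝ≥0) :
    bigJumps f ε (t + s) =
      bigJumps f ε t ∪ (t + ·) '' bigJumps (JumpProcesses.incrementPath f t) ε s := by
  ext r
  constructor
  · rintro ⟨⟨h0, hr⟩, hj⟩
    rcases le_or_gt r t with h | h
    · exact Or.inl ⟨⟨h0, h⟩, hj⟩
    · have hpos : 0 < r - t := tsub_pos_of_lt h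
      have hadd : t + (r - t) = r := add_tsub_cancel_of_le h.le
      refine Or.inr ⟨r - t, ⟨⟨hpos, tsub_le_iff_left.2 hr⟩, ?_⟩, hadd⟩
      rw [hf.jump_incrementPath t hpos, hadd]
      exact hj
  · rintro (⟨⟨h0, hr⟩, hj⟩ | ⟨u, ⟨⟨h0, hu⟩, hj⟩, rfl⟩)
    · exact ⟨⟨h0, hr.trans le_self_add⟩, hj⟩
    · rw [hf.jump_incrementPath t h0] at hj
      exact ⟨⟨h0.trans_le le_add_self, add_le_add_right hu t⟩, hj⟩

theorem IsCadlag.jumpSum_add (hf : IsCadlag f) {ε : ℝ} (hε : 0 < ε) {G : Type*} [AddCommMonoid G]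
    (h : EuclideanSpace ℝ (Fin n) → G) (t s : ℝ≥0) :
    jumpSum h ε f (t + s) =
      jumpSum h ε f t + jumpSum h ε (JumpProcesses.incrementPath f t) s := by
  unfold jumpSum
  rw [hf.bigJumps_add, finsum_mem_union _ (hf.finite_bigJumps hε t)
    (((hf.incrementPath t).finite_bigJumps hε s).image _),
    finsum_mem_image (add_right_injective t).injOn]
  · congr 1
    exact finsum_mem_congr rfl fun u hu => by rw [hf.jump_incrementPath t hu.1.1]
  · rw [Set.disjoint_left]
    rintro r hr ⟨u, hu, rfl⟩
    exact absurd hr.1.2 (not_le.2 (lt_add_of_pos_right t hu.1.1))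

theorem jumpSum_time_zero {G : Type*} [AddCommMonoid G] (h : EuclideanSpace ℝ (Fin n) → G)
    (ε : ℝ) : jumpSum h ε f 0 = 0 := by
  have : bigJumps f ε 0 = ∅ := by
    ext r
    simp [bigJumps]
  rw [jumpSum, this, finsum_mem_empty]

theorem IsCadlag.jumpSum_incrementPath_zero (hf : IsCadlag f) {ε : ℝ} (hε : 0 < ε) {G : Type*}
    [AddCommMonoid G] (h : EuclideanSpace ℝ (Fin n) → G) (s : ℝ≥0) :
    jumpSum h ε (JumpProcesses.incrementPath f 0) s = jumpSum h ε f s := by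
  simpa [jumpSum_time_zero] using (hf.jumpSum_add hε h 0 s).symm

/-- The finitely many big jump times in `(0, 1]` are bounded away from `0`. This is the source of
continuity in probability. -/
theorem IsCadlag.eventually_jumpSum_eq_zero (hf : IsCadlag f) {ε : ℝ} (hε : 0 < ε) {G : Type*}
    [AddCommMonoid G] (h : EuclideanSpace ℝ (Fin n) → G) :
    ∀ᶠ s in 𝓝 0, jumpSum h ε f s = 0 := by
  have h1 : ∀ᶠ s : ℝ≥0 in 𝓝 0, ∀ r ∈ bigJumps f ε 1, s < r :=
    (Filter.eventually_all_finite (hf.finite_bigJumps hε 1)).2 fun r hr => gt_mem_nhds hr.1.1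
  filter_upwards [h1, gt_mem_nhds (zero_lt_one (α := ℝ≥0))] with s hs hs1
  have : bigJumps f ε s = ∅ := by
    ext r
    simp only [Set.mem_empty_iff_false, iff_false]
    intro hr
    exact absurd (hs r ⟨⟨hr.1.1, hr.1.2.trans hs1.le⟩, hr.2⟩) (not_lt.2 hr.1.2)
  rw [jumpSum, this, finsum_mem_empty]

end Increments

/-! ### The successive jump times enumerate the jumps in `B`. -/

section JumpTimes

variable {n : ℕ} {f : ℝ≥0 → EuclideanSpace ℝ (Fin n)} {B : Set (EuclideanSpace ℝ (Fin n))}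

theorem jumpTime_succ_le {k : ℕ} {r : ℝ≥0} (h1 : jumpTime f B k < r) (h2 : jump f r ∈ B) :
    jumpTime f B (k + 1) ≤ r := by
  rw [jumpTime]
  exact sInf_le ⟨r, ⟨h1, h2⟩, rfl⟩

/-- The infimum is attained because only finitely many candidates lie below any given one. -/
theorem IsCadlag.exists_jumpTime_succ_eq (hf : IsCadlag f) {ε : ℝ} (hε : 0 < ε)
    (hB : ∀ x ∈ B, ε ≤ ‖x‖) {k : ℕ} (hk : jumpTime f B (k + 1) ≠ ∞) :
    ∃ s : ℝ≥0, jumpTime f B (k + 1) = s ∧ jumpTime f B k < s ∧ jump f s ∈ B := by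
  rw [jumpTime] at hk ⊢
  obtain ⟨a, ha⟩ : {t : ℝ≥0 | jumpTime f B k < (t : ℝ≥0∞) ∧ jump f t ∈ B}.Nonempty := by
    by_contra! h
    exact hk (by rw [h, Set.image_empty, sInf_empty])
  have hfin : ({t : ℝ≥0 | jumpTime f B k < (t : ℝ≥0∞) ∧ jump f t ∈ B} ∩ Set.Iic a).Finite :=
    (hf.finite_bigJumps hε a).subset fun r hr =>
      ⟨⟨ENNReal.coe_pos.1 (pos_of_gt hr.1.1), hr.2⟩, hB _ hr.1.2⟩
  obtain ⟨s, hs, hmin⟩ := Set.exists_min_image _ id hfin ⟨a, ha, le_refl a⟩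
  refine ⟨s, IsLeast.csInf_eq ⟨⟨s, hs.1, rfl⟩, ?_⟩, hs.1⟩
  rintro _ ⟨r, hr, rfl⟩
  refine ENNReal.coe_le_coe.2 ?_
  rcases le_or_gt r a with h | h
  · exact hmin r ⟨hr, h⟩
  · exact hs.2.trans h.le

theorem IsCadlag.jumpTime_lt_succ (hf : IsCadlag f) {ε : ℝ} (hε : 0 < ε)
    (hB : ∀ x ∈ B, ε ≤ ‖x‖) {k : ℕ} (hk : jumpTime f B k ≠ ∞) :
    jumpTime f B k < jumpTime f B (k + 1) := by
  by_cases h : jumpTime f B (k + 1) = ∞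
  · rw [h]
    exact lt_top_iff_ne_top.2 hk
  · obtain ⟨s, hs, hlt, -⟩ := hf.exists_jumpTime_succ_eq hε hB h
    rwa [hs]

theorem IsCadlag.jumpTime_mono (hf : IsCadlag f) {ε : ℝ} (hε : 0 < ε)
    (hB : ∀ x ∈ B, ε ≤ ‖x‖) : Monotone (jumpTime f B) := by
  refine monotone_nat_of_le_succ fun k => ?_
  by_cases hk : jumpTime f B k = ∞
  · rw [jumpTime]
    refine le_sInf ?_
    rintro _ ⟨r, hr, rfl⟩
    exact hr.1.le
  · exact (hf.jumpTime_lt_succ hε hB hk).le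

theorem IsCadlag.jumpTime_lt (hf : IsCadlag f) {ε : ℝ} (hε : 0 < ε)
    (hB : ∀ x ∈ B, ε ≤ ‖x‖) {i j : ℕ} (hij : i < j) (hi : jumpTime f B i ≠ ∞) :
    jumpTime f B i < jumpTime f B j :=
  (hf.jumpTime_lt_succ hε hB hi).trans_le (hf.jumpTime_mono hε hB hij)

theorem IsCadlag.jumpTime_injOn (hf : IsCadlag f) {ε : ℝ} (hε : 0 < ε)
    (hB : ∀ x ∈ B, ε ≤ ‖x‖) : Set.InjOn (jumpTime f B) {k | jumpTime f B k ≠ ∞} := by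
  intro i hi j hj hij
  rcases lt_trichotomy i j with h | h | h
  · exact absurd hij (hf.jumpTime_lt hε hB h hi).ne
  · exact h
  · exact absurd hij (hf.jumpTime_lt hε hB h hj).ne'

/-- The indices of the jumps in `B` up to time `t` inject into the times of the jumps. -/
theorem IsCadlag.injOn_jumpTime_succ (hf : IsCadlag f) {ε : ℝ} (hε : 0 < ε)
    (hB : ∀ x ∈ B, ε ≤ ‖x‖) (t : ℝ≥0) :
    Set.InjOn (fun k => (jumpTime f B (k + 1)).toNNReal)
      {k | jumpTime f B (k + 1) ≤ (t : ℝ≥0∞)} := by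
  intro i hi j hj hij
  have hi' : jumpTime f B (i + 1) ≠ ∞ := ne_top_of_le_ne_top ENNReal.coe_ne_top hi
  have hj' : jumpTime f B (j + 1) ≠ ∞ := ne_top_of_le_ne_top ENNReal.coe_ne_top hj
  exact Nat.succ_injective (hf.jumpTime_injOn hε hB hi' hj' ((ENNReal.toNNReal_eq_toNNReal_iff'
    hi' hj').1 hij))

theorem IsCadlag.mapsTo_jumpTime_succ (hf : IsCadlag f) {ε : ℝ} (hε : 0 < ε)
    (hB : ∀ x ∈ B, ε ≤ ‖x‖) (t : ℝ≥0) {k : ℕ} (hk : jumpTime f B (k + 1) ≤ (t : ℝ≥0∞)) :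
    (jumpTime f B (k + 1)).toNNReal ∈ {s | s ∈ bigJumps f ε t ∧ jump f s ∈ B} := by
  obtain ⟨s, hs, hlt, hj⟩ :=
    hf.exists_jumpTime_succ_eq hε hB (ne_top_of_le_ne_top ENNReal.coe_ne_top hk)
  rw [hs] at hk ⊢
  rw [ENNReal.toNNReal_coe]
  exact ⟨⟨⟨ENNReal.coe_pos.1 (pos_of_gt hlt), ENNReal.coe_le_coe.1 hk⟩, hB _ hj⟩, hj⟩

theorem IsCadlag.finite_jumpTime_succ_le (hf : IsCadlag f) {ε : ℝ} (hε : 0 < ε)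
    (hB : ∀ x ∈ B, ε ≤ ‖x‖) (t : ℝ≥0) : {k | jumpTime f B (k + 1) ≤ (t : ℝ≥0∞)}.Finite := by
  refine Set.Finite.of_injOn (fun k hk => ?_) (hf.injOn_jumpTime_succ hε hB t)
    (hf.finite_bigJumps hε t)
  exact (hf.mapsTo_jumpTime_succ hε hB t hk).1

/-- Were `s` skipped, induction would keep every jump time strictly below `s`, against the
finiteness of the set of indices with jump time at most `s`. -/
theorem IsCadlag.exists_jumpTime_succ_of_mem (hf : IsCadlag f) {ε : ℝ} (hε : 0 < ε)
    (hB : ∀ x ∈ B, ε ≤ ‖x‖) {s : ℝ≥0} (hs : 0 < s) (hsB : jump f s ∈ B) :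
    ∃ k, jumpTime f B (k + 1) = s := by
  by_contra! hne
  have hlt : ∀ k, jumpTime f B k < s := by
    intro k
    induction k with
    | zero =>
      rw [jumpTime]
      exact ENNReal.coe_pos.2 hs
    | succ k ih => exact lt_of_le_of_ne (jumpTime_succ_le ih hsB) (hne k)
  have hfin := hf.finite_jumpTime_succ_le hε hB s
  refine Set.infinite_univ (hfin.subset fun k _ => ?_)
  exact (hlt (k + 1)).le

theorem jumpProcess_eq_jumpSum {Ω : Type*} {X : ℝ≥0 → Ω → EuclideanSpace ℝ (Fin n)} {ω : Ω}
    (hf : IsCadlag fun s => X s ω) {ε : ℝ} (hε : 0 < ε) (hB : ∀ x ∈ B, ε ≤ ‖x‖) (t : ℝ≥0) :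
    jumpProcess X B t ω = jumpSum (B.indicator id) ε (fun s => X s ω) t := by
  classical
  have hmem : ∀ k, k ∈ (hf.finite_jumpTime_succ_le hε hB t).toFinset ↔
      jumpTime (fun s => X s ω) B (k + 1) ≤ (t : ℝ≥0∞) := fun k => Set.Finite.mem_toFinset _
  rw [jumpProcess, hf.jumpSum_eq_sum hε,
    tsum_eq_sum (s := (hf.finite_jumpTime_succ_le hε hB t).toFinset)]
  · rw [← Finset.sum_filter_of_ne (p := fun s => jump (fun s => X s ω) s ∈ B)]
    · refine Finset.sum_nbij (fun k => (jumpTime (fun s => X s ω) B (k + 1)).toNNReal) ?_ ?_ ?_ ?_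
      · intro k hk
        have := hf.mapsTo_jumpTime_succ hε hB t ((hmem k).1 hk)
        simpa using this
      · simpa using hf.injOn_jumpTime_succ hε hB t
      · intro s hs
        simp only [Finset.coe_filter, Set.Finite.mem_toFinset, Set.mem_ofPred_eq] at hs
        obtain ⟨k, hk⟩ := hf.exists_jumpTime_succ_of_mem hε hB hs.1.1.1 hs.2
        refine ⟨k, ?_, by simp [hk]⟩
        simpa [hk] using hs.1.1.2
      · intro k hk
        have hk' := (hmem k).1 hk
        have := (hf.mapsTo_jumpTime_succ hε hB t hk').2
        rw [if_pos hk', Set.indicator_of_mem this, id]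
    · intro s _ hs
      by_contra h
      exact hs (Set.indicator_of_notMem h _)
  · intro k hk
    rw [if_neg fun h => hk ((hmem k).2 h)]

theorem exists_pos_forall_le_norm (h0 : (0 : EuclideanSpace ℝ (Fin n)) ∉ closure B) :
    ∃ ε : ℝ, 0 < ε ∧ ∀ x ∈ B, ε ≤ ‖x‖ := by
  obtain ⟨ε, hε, h⟩ := Metric.nhds_basis_ball.mem_iff.1 (isClosed_closure.isOpen_compl.mem_nhds h0)
  refine ⟨ε, hε, fun x hx => ?_⟩
  by_contra! hlt
  exact h (mem_ball_zero_iff.2 hlt) (subset_closure hx)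

end JumpTimes

/-! ### Measurability of jump sums, through the point measure of the jumps. -/

section Measurability

variable {n : ℕ} {f : ℝ≥0 → EuclideanSpace ℝ (Fin n)}

theorem IsCadlag.tendsto_jumpSum (hf : IsCadlag f) {ε : ℝ} (hε : 0 < ε) {t : ℝ≥0} {G : Type*}
    [AddCommMonoid G] [TopologicalSpace G] [ContinuousAdd G]
    {h : ℕ → EuclideanSpace ℝ (Fin n) → G} {h' : EuclideanSpace ℝ (Fin n) → G}
    (hlim : ∀ s ∈ bigJumps f ε t, Tendsto (fun k => h k (jump f s)) atTop (𝓝 (h' (jump f s)))) :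
    Tendsto (fun k => jumpSum (h k) ε f t) atTop (𝓝 (jumpSum h' ε f t)) := by
  simp_rw [hf.jumpSum_eq_sum hε]
  exact tendsto_finsetSum _ fun s hs => hlim s ((Set.Finite.mem_toFinset _).1 hs)

/-- The point measure of the jumps of size at least `ε` up to time `t`. -/
noncomputable def jumpMeasure (ε : ℝ) (f : ℝ≥0 → EuclideanSpace ℝ (Fin n)) (t : ℝ≥0) :
    Measure (EuclideanSpace ℝ (Fin n)) :=
  jumpSum Measure.dirac ε f t

theorem IsCadlag.jumpMeasure_eq_sum (hf : IsCadlag f) {ε : ℝ} (hε : 0 < ε) (t : ℝ≥0) :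
    jumpMeasure ε f t =
      ∑ s ∈ (hf.finite_bigJumps hε t).toFinset, Measure.dirac (jump f s) :=
  hf.jumpSum_eq_sum hε t _

theorem IsCadlag.jumpMeasure_apply (hf : IsCadlag f) {ε : ℝ} (hε : 0 < ε) (t : ℝ≥0)
    {A : Set (EuclideanSpace ℝ (Fin n))} (hA : MeasurableSet A) :
    jumpMeasure ε f t A = jumpSum (A.indicator 1) ε f t := by
  rw [hf.jumpMeasure_eq_sum hε, hf.jumpSum_eq_sum hε, Measure.finsetSum_apply]
  exact Finset.sum_congr rfl fun s _ => Measure.dirac_apply' _ hA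

theorem IsCadlag.isFiniteMeasure_jumpMeasure (hf : IsCadlag f) {ε : ℝ} (hε : 0 < ε) (t : ℝ≥0) :
    IsFiniteMeasure (jumpMeasure ε f t) := by
  rw [hf.jumpMeasure_eq_sum hε]
  infer_instance

theorem IsCadlag.integral_jumpMeasure (hf : IsCadlag f) {ε : ℝ} (hε : 0 < ε) (t : ℝ≥0)
    {G : Type*} [NormedAddCommGroup G] [NormedSpace ℝ G] [CompleteSpace G]
    (h : EuclideanSpace ℝ (Fin n) → G) :
    ∫ x, h x ∂(jumpMeasure ε f t) = jumpSum h ε f t := by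
  rw [hf.jumpMeasure_eq_sum hε, hf.jumpSum_eq_sum hε, integral_finsetSum_measure]
  · exact Finset.sum_congr rfl fun s _ => integral_dirac _ _
  · intro s _
    exact integrable_dirac (by simp)

variable {α : Type*} [MeasurableSpace α] {Y : ℝ≥0 → α → EuclideanSpace ℝ (Fin n)}

theorem measurable_jumpSum_of_continuous {t : ℝ≥0} (hY : ∀ a, IsCadlag fun s => Y s a)
    (hm : ∀ s ≤ t, Measurable (Y s)) {ε : ℝ} (hε : 0 < ε)
    {h : EuclideanSpace ℝ (Fin n) → ℝ≥0∞} (hc : Continuous h) (h0 : ∀ x, ‖x‖ < ε → h x = 0) :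
    Measurable fun a => jumpSum h ε (fun s => Y s a) t := by
  refine measurable_of_tendsto_metrizable
    (f := fun m a => ∑ i ∈ Finset.range (m + 1), h (Y (grid t m (i + 1)) a - Y (grid t m i) a))
    (fun m => ?_) (tendsto_pi_nhds.2 fun a => (hY a).tendsto_sum_increments hε t hc h0)
  refine Finset.measurable_sum _ fun i hi => hc.measurable.comp ?_
  have hle : grid t m (i + 1) ≤ t :=
    (grid_mono t m (Finset.mem_range.1 hi)).trans_eq (grid_last t m)
  exact (hm _ hle).sub (hm _ ((grid_mono t m i.le_succ).trans hle))

/-- Intersecting `C` with the closed set `{ε ≤ ‖x‖}` changes no mass and keeps it away from `0`.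
Thickened indicators of radius at most `ε / 2` are then continuous, vanish on the ball of radius `ε
/ 2`, and converge to the indicator. -/
theorem measurable_jumpMeasure_apply_of_isClosed {t : ℝ≥0} (hY : ∀ a, IsCadlag fun s => Y s a)
    (hm : ∀ s ≤ t, Measurable (Y s)) {ε : ℝ} (hε : 0 < ε)
    {C : Set (EuclideanSpace ℝ (Fin n))} (hC : IsClosed C) :
    Measurable fun a => jumpMeasure ε (fun s => Y s a) t C := by
  set D : Set (EuclideanSpace ℝ (Fin n)) := C ∩ {x | ε ≤ ‖x‖} with hD
  have hDc : IsClosed D := hC.inter (isClosed_le continuous_const continuous_norm)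
  have hDε : ∀ x, ‖x‖ < ε → x ∉ D := fun x hx hxD => absurd hx (not_lt.2 hxD.2)
  set δ : ℕ → ℝ := fun k => (ε / 2) * (1 / ((k : ℝ) + 1)) with hδ
  have hδpos : ∀ k, 0 < δ k := fun k => by positivity
  have hδle : ∀ k, δ k ≤ ε / 2 := fun k => by
    refine mul_le_of_le_one_right (by positivity) ?_
    rw [div_le_one (by positivity)]
    linarith [Nat.cast_nonneg (α := ℝ) k]
  have hδlim : Tendsto δ atTop (𝓝 0) := by
    simpa [hδ] using (tendsto_one_div_add_atTop_nhds_zero_nat (𝕜 := ℝ)).const_mul (ε / 2)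
  have hzero : ∀ k x, ‖x‖ < ε / 2 → thickenedIndicatorAux (δ k) D x = 0 := by
    refine fun k x hx => thickenedIndicatorAux_zero (hδpos k) _ fun hmem => ?_
    obtain ⟨z, hz, hd⟩ := Metric.mem_thickening_iff.1 hmem
    have h1 : ‖z‖ ≤ ‖x‖ + dist x z := by
      rw [dist_eq_norm, ← norm_neg (x - z)]
      simpa using norm_add_le x (-(x - z))
    have h2 : ε ≤ ‖z‖ := hz.2
    linarith [hδle k]
  have hmeas : ∀ k, Measurable fun a => jumpSum (thickenedIndicatorAux (δ k) D) (ε / 2)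
      (fun s => Y s a) t := fun k => measurable_jumpSum_of_continuous hY hm (half_pos hε)
    (continuous_thickenedIndicatorAux (hδpos k) D) (hzero k)
  refine measurable_of_tendsto_metrizable hmeas (tendsto_pi_nhds.2 fun a => ?_)
  have hlim := (hY a).tendsto_jumpSum (half_pos hε) (t := t) fun s _ =>
    tendsto_pi_nhds.1 (thickenedIndicatorAux_tendsto_indicator_closure hδlim D)
      (jump (fun s => Y s a) s)
  rw [hDc.closure_eq] at hlim
  convert hlim using 2
  rw [(hY a).jumpMeasure_apply hε t hC.measurableSet]
  have hD0 : ∀ x, ‖x‖ < ε → D.indicator (fun _ => (1 : ℝ≥0∞)) x = 0 := fun x hx =>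
    Set.indicator_of_notMem (hDε x hx) _
  rw [(hY a).jumpSum_congr_level (half_pos hε) hε t
    (fun x hx => hD0 x (hx.trans (half_lt_self hε))) hD0]
  refine finsum_mem_congr rfl fun s hs => ?_
  by_cases hsC : jump (fun s => Y s a) s ∈ C
  · rw [Set.indicator_of_mem hsC, Set.indicator_of_mem (show _ ∈ D from ⟨hsC, hs.2⟩), Pi.one_apply]
  · rw [Set.indicator_of_notMem hsC, Set.indicator_of_notMem fun h => hsC h.1]

theorem measurable_jumpMeasure {t : ℝ≥0} (hY : ∀ a, IsCadlag fun s => Y s a)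
    (hm : ∀ s ≤ t, Measurable (Y s)) {ε : ℝ} (hε : 0 < ε) :
    Measurable fun a => jumpMeasure ε (fun s => Y s a) t := by
  have := fun a => (hY a).isFiniteMeasure_jumpMeasure hε t
  refine Measurable.measure_of_isPiSystem (S := {C | IsClosed C}) ?_ isPiSystem_isClosed
    (fun C hC => measurable_jumpMeasure_apply_of_isClosed hY hm hε hC)
    (measurable_jumpMeasure_apply_of_isClosed hY hm hε isClosed_univ)
  rw [← borel_eq_generateFrom_isClosed]
  exact BorelSpace.measurable_eq

/-- For a simple function the jump sum is a finite combination of masses of the jump measure. Only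
the coordinates up to `t` need to be measurable, so taking `F t` as the σ-algebra yields
adaptedness. -/
theorem stronglyMeasurable_jumpSum {t : ℝ≥0} (hY : ∀ a, IsCadlag fun s => Y s a)
    (hm : ∀ s ≤ t, Measurable (Y s)) {ε : ℝ} (hε : 0 < ε) {G : Type*} [NormedAddCommGroup G]
    [NormedSpace ℝ G] [CompleteSpace G] {h : EuclideanSpace ℝ (Fin n) → G}
    (hh : StronglyMeasurable h) :
    StronglyMeasurable fun a => jumpSum h ε (fun s => Y s a) t := by
  refine stronglyMeasurable_of_tendsto atTop
    (f := fun k a => jumpSum (hh.approx k) ε (fun s => Y s a) t) (fun k => ?_)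
    (tendsto_pi_nhds.2 fun a => (hY a).tendsto_jumpSum hε fun s _ => hh.tendsto_approx _)
  have hfin := fun a => (hY a).isFiniteMeasure_jumpMeasure hε t
  have heq : (fun a => jumpSum (hh.approx k) ε (fun s => Y s a) t) = fun a =>
      ∑ x ∈ (hh.approx k).range,
        (jumpMeasure ε (fun s => Y s a) t (hh.approx k ⁻¹' {x})).toReal • x := by
    funext a
    rw [← (hY a).integral_jumpMeasure hε,
      SimpleFunc.integral_eq_sum _ ((hh.approx k).integrable_of_isFiniteMeasure)]
    rfl
  rw [heq]
  refine Finset.stronglyMeasurable_fun_sum _ fun x _ => StronglyMeasurable.smul_const ?_ x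
  refine (Measurable.ennreal_toReal ?_).stronglyMeasurable
  exact (Measure.measurable_coe ((hh.approx k).measurableSet_fiber x)).comp
    (measurable_jumpMeasure hY hm hε)

end Measurability

/-! ### Independence of processes built from independent increments. -/

section Independence

variable {Ω : Type*} {mΩ : MeasurableSpace Ω} {P : Measure Ω} [IsProbabilityMeasure P]

theorem isPiSystem_image2_inter (m₁ m₂ : MeasurableSpace Ω) :
    IsPiSystem (Set.image2 (· ∩ ·) {s | MeasurableSet[m₁] s} {s | MeasurableSet[m₂] s}) := by
  rintro _ ⟨a, ha, b, hb, rfl⟩ _ ⟨c, hc, d, hd, rfl⟩ _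
  exact ⟨a ∩ c, MeasurableSet.inter ha hc, b ∩ d, MeasurableSet.inter hb hd,
    Set.inter_inter_inter_comm _ _ _ _⟩

theorem generateFrom_image2_inter (m₁ m₂ : MeasurableSpace Ω) :
    m₁ ⊔ m₂ = MeasurableSpace.generateFrom
      (Set.image2 (· ∩ ·) {s | MeasurableSet[m₁] s} {s | MeasurableSet[m₂] s}) := by
  refine le_antisymm (sup_le (fun s hs => ?_) fun s hs => ?_) (MeasurableSpace.generateFrom_le ?_)
  · exact MeasurableSpace.measurableSet_generateFrom
      ⟨s, hs, Set.univ, MeasurableSet.univ, Set.inter_univ s⟩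
  · exact MeasurableSpace.measurableSet_generateFrom
      ⟨Set.univ, MeasurableSet.univ, s, hs, Set.univ_inter s⟩
  · rintro _ ⟨a, ha, b, hb, rfl⟩
    exact MeasurableSet.inter ((le_sup_left : m₁ ≤ m₁ ⊔ m₂) _ ha)
      ((le_sup_right : m₂ ≤ m₁ ⊔ m₂) _ hb)

/-- Two independent pairs of independent σ-algebras can be regrouped. -/
theorem indep_sup_sup {a c a' c' : MeasurableSpace Ω} (ha : a ≤ mΩ) (hc : c ≤ mΩ) (ha' : a' ≤ mΩ)
    (hc' : c' ≤ mΩ) (h1 : Indep a a' P) (h2 : Indep c c' P) (h3 : Indep (a ⊔ a') (c ⊔ c') P) :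
    Indep (a ⊔ c) (a' ⊔ c') P := by
  refine IndepSets.indep (sup_le ha hc) (sup_le ha' hc') (isPiSystem_image2_inter a c)
    (isPiSystem_image2_inter a' c') (generateFrom_image2_inter a c)
    (generateFrom_image2_inter a' c') ?_
  rw [IndepSets_iff]
  rintro _ _ ⟨s, hs, t, ht, rfl⟩ ⟨s', hs', t', ht', rfl⟩
  have l1 : a ≤ a ⊔ a' := le_sup_left
  have l2 : a' ≤ a ⊔ a' := le_sup_right
  have l3 : c ≤ c ⊔ c' := le_sup_left
  have l4 : c' ≤ c ⊔ c' := le_sup_right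
  rw [Indep_iff] at h1 h2 h3
  rw [Set.inter_inter_inter_comm, h3 _ _ (MeasurableSet.inter (l1 _ hs) (l2 _ hs'))
    (MeasurableSet.inter (l3 _ ht) (l4 _ ht')), h1 _ _ hs hs', h2 _ _ ht ht',
    h3 _ _ (l1 _ hs) (l3 _ ht), h3 _ _ (l2 _ hs') (l4 _ ht')]
  ring

theorem indep_sup_left {a c b : MeasurableSpace Ω} (ha : a ≤ mΩ) (hc : c ≤ mΩ) (hb : b ≤ mΩ)
    (h1 : Indep a b P) (h2 : Indep c (a ⊔ b) P) : Indep (a ⊔ c) b P := by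
  have := indep_sup_sup ha hc hb bot_le h1 (indep_bot_right c)
    (by rw [sup_bot_eq]; exact h2.symm)
  rwa [sup_bot_eq] at this

section ExtendPath

variable {G : Type*} [AddCommGroup G]

/-- Extends a family indexed by `s` to `insert a s`, given its increment from the last time of
`s` (or from `0`, where the family is understood to vanish) to `a`. -/
noncomputable def extendPath (s : Finset ℝ≥0) (a : ℝ≥0) (q : (s → G) × G) :
    ((insert a s : Finset ℝ≥0) : Type) → G :=
  fun r => if h : (r : ℝ≥0) ∈ s then q.1 ⟨r, h⟩
    else (if h : s.sup id ∈ s then q.1 ⟨s.sup id, h⟩ else 0) + q.2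

theorem extendPath_eq {s : Finset ℝ≥0} {a : ℝ≥0} {w : ℝ≥0 → G} (h0 : w 0 = 0) :
    extendPath s a (fun r => w r, w a - w (s.sup id)) =
      fun r : (insert a s : Finset ℝ≥0) => w r := by
  funext ⟨r, hr⟩
  unfold extendPath
  by_cases h : r ∈ s
  · simp [h]
  · have hra : r = a := (Finset.mem_insert.1 hr).resolve_right h
    rcases s.eq_empty_or_nonempty with rfl | hs
    -- For empty `s` the supremum is `0`, so the increment starts at `w 0 = 0`.
    · simp [hra, h0]
    · have hmem : s.sup id ∈ s := by
        obtain ⟨b, hb, hb'⟩ := Finset.exists_mem_eq_sup s hs id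
        rw [hb']
        exact hb
      simp [hmem, hra]

theorem measurable_extendPath [MeasurableSpace G] [MeasurableAdd₂ G] (s : Finset ℝ≥0) (a : ℝ≥0) :
    Measurable (extendPath (G := G) s a) := by
  refine measurable_pi_lambda _ fun r => ?_
  unfold extendPath
  split_ifs
  · fun_prop
  · fun_prop
  · fun_prop

end ExtendPath

theorem sup_id_le {s : Finset ℝ≥0} {a : ℝ≥0} (h : ∀ x ∈ s, x < a) : s.sup id ≤ a :=
  Finset.sup_le fun x hx => (h x hx).le

/-- Two adapted processes with jointly independent increments, the increments of which are
independent of each other, are independent. -/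
theorem indepFun_of_indep_increments {G : Type*} [AddCommGroup G] [MeasurableSpace G]
    [MeasurableAdd₂ G] [MeasurableSub₂ G] (F : Filtration ℝ≥0 mΩ) {U V : ℝ≥0 → Ω → G}
    (hU : ∀ t, Measurable[F t] (U t)) (hV : ∀ t, Measurable[F t] (V t))
    (hU0 : ∀ ω, U 0 ω = 0) (hV0 : ∀ ω, V 0 ω = 0)
    (hUV : ∀ t s, Indep (MeasurableSpace.comap (fun ω => U (t + s) ω - U t ω) inferInstance ⊔
      MeasurableSpace.comap (fun ω => V (t + s) ω - V t ω) inferInstance) (F t) P)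
    (hind : ∀ t s, IndepFun (fun ω => U (t + s) ω - U t ω) (fun ω => V (t + s) ω - V t ω) P) :
    IndepFun (fun ω t => U t ω) (fun ω t => V t ω) P := by
  classical
  have hU' : ∀ t, Measurable (U t) := fun t => (hU t).mono (F.le t) le_rfl
  have hV' : ∀ t, Measurable (V t) := fun t => (hV t).mono (F.le t) le_rfl
  -- The same finite set of times serves both processes, so that adding a largest time adds one
  -- increment to each. Different sets `I`, `J` are reached through `I ∪ J`.
  have key : ∀ I : Finset ℝ≥0,
      IndepFun (fun ω (i : I) => U i ω) (fun ω (i : I) => V i ω) P := by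
    intro I
    induction I using Finset.induction_on_max with
    | empty =>
      have : (fun ω (i : (∅ : Finset ℝ≥0)) => V i ω) = fun _ => isEmptyElim := by
        funext ω i
        exact isEmptyElim i
      rw [this]
      exact indepFun_const_right _ _
    | insert a s hmax ih =>
      have hba : s.sup id ≤ a := sup_id_le hmax
      set b := s.sup id with hb
      have hadd : b + (a - b) = a := add_tsub_cancel_of_le hba
      have hinc := hUV b (a - b)
      have hincI := hind b (a - b)
      rw [hadd] at hinc hincI
      have hsF : ∀ W : ℝ≥0 → Ω → G, (∀ t, Measurable[F t] (W t)) →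
          MeasurableSpace.comap (fun ω (i : s) => W i ω) inferInstance ≤ F b := by
        intro W hW
        refine Measurable.comap_le ?_
        refine @measurable_pi_lambda _ _ _ (F b) _ _ fun i => (hW i).mono (F.mono ?_) le_rfl
        exact Finset.le_sup (f := id) i.2
      have hmeas : ∀ W : ℝ≥0 → Ω → G, (∀ t, Measurable (W t)) →
          Measurable fun ω => W a ω - W b ω := fun W hW => (hW a).sub (hW b)
      have hpair := indep_sup_sup ((hsF U hU).trans (F.le b)) (hmeas U hU').comap_le
        ((hsF V hV).trans (F.le b)) (hmeas V hV').comap_le ih hincI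
        (indep_of_indep_of_le_left hinc.symm (sup_le (hsF U hU) (hsF V hV)))
      rw [← MeasurableSpace.comap_prodMk, ← MeasurableSpace.comap_prodMk] at hpair
      have hfun : IndepFun (fun ω => ((fun i : s => U i ω), U a ω - U b ω))
        (fun ω => ((fun i : s => V i ω), V a ω - V b ω)) P := hpair
      have := hfun.comp (measurable_extendPath s a) (measurable_extendPath s a)
      convert this using 1
      · funext ω
        exact (extendPath_eq (w := fun r => U r ω) (hU0 ω)).symm
      · funext ω
        exact (extendPath_eq (w := fun r => V r ω) (hV0 ω)).symm
  refine IndepFun.process_indepFun_process hU' hV' fun I J => ?_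
  exact (key (I ∪ J)).comp
    (Finset.measurable_restrict₂ (X := fun _ => G) Finset.subset_union_left)
    (Finset.measurable_restrict₂ (X := fun _ => G) Finset.subset_union_right)

end Independence

/-! ### The path of increments after `t`: independent of the past, with law independent of `t`. -/

section IncrementPaths

variable {Ω : Type*} {mΩ : MeasurableSpace Ω} {P : Measure Ω}
  {F : Filtration ℝ≥0 mΩ} {n : ℕ} {X : ℝ≥0 → Ω → EuclideanSpace ℝ (Fin n)}

theorem IsLevyProcess.measurable (hX : IsLevyProcess F P X) (t : ℝ≥0) : Measurable (X t) :=
  (hX.adapted t).mono (F.le t) le_rfl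

variable (n) in
/-- The space of càdlàg paths, with the σ-algebra generated by the coordinates. -/
abbrev CadlagPath : Type :=
  {f : ℝ≥0 → EuclideanSpace ℝ (Fin n) // IsCadlag f}

/-- The increments of `X` after time `t`, as a random càdlàg path. -/
def incrementsFrom (hc : ∀ ω, IsCadlag fun t => X t ω) (t : ℝ≥0) (ω : Ω) : CadlagPath n :=
  ⟨incrementPath (fun s => X s ω) t, (hc ω).incrementPath t⟩

theorem IsLevyProcess.measurable_incrementsFrom (hX : IsLevyProcess F P X)
    (hc : ∀ ω, IsCadlag fun t => X t ω) (t : ℝ≥0) : Measurable (incrementsFrom hc t) :=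
  Measurable.subtype_mk (measurable_pi_lambda _ fun _ => (hX.measurable _).sub (hX.measurable _))

variable [IsProbabilityMeasure P]

/-- Finitely many increments of a Lévy process after time `t` are independent of the past, and
their joint law does not depend on `t`. -/
theorem IsLevyProcess.finset_increments (hX : IsLevyProcess F P X) (t : ℝ≥0) (I : Finset ℝ≥0) :
    Indep (MeasurableSpace.comap (fun ω (r : I) => X (t + r) ω - X t ω) inferInstance) (F t) P ∧
      P.map (fun ω (r : I) => X (t + r) ω - X t ω) =
        P.map (fun ω (r : I) => X (0 + r) ω - X 0 ω) := by
  classical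
  have hm : ∀ t (I : Finset ℝ≥0), Measurable fun ω (r : I) => X (t + r) ω - X t ω := fun t I =>
    measurable_pi_lambda _ fun r => (hX.measurable _).sub (hX.measurable _)
  have hmz : ∀ t u, Measurable fun ω => X u ω - X t ω := fun t u =>
    (hX.measurable _).sub (hX.measurable _)
  have hpast : ∀ t (s : Finset ℝ≥0),
      MeasurableSpace.comap (fun ω (r : s) => X (t + r) ω - X t ω) inferInstance ≤
        F (t + s.sup id) := by
    intro t s
    refine Measurable.comap_le (@measurable_pi_lambda _ _ _ (F (t + s.sup id)) _ _ fun r => ?_)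
    refine Measurable.sub ((hX.adapted _).mono (F.mono (add_le_add_right ?_ t)) le_rfl)
      ((hX.adapted _).mono (F.mono le_self_add) le_rfl)
    exact Finset.le_sup (f := id) r.2
  have hstep : ∀ t a (s : Finset ℝ≥0), s.sup id ≤ a →
      Indep (MeasurableSpace.comap (fun ω => X (t + a) ω - X (t + s.sup id) ω) inferInstance)
        (F (t + s.sup id)) P := by
    intro t a s hba
    have := hX.indep_increment (t + s.sup id) (a - s.sup id)
    rwa [add_assoc, add_tsub_cancel_of_le hba] at this
  have hext : ∀ t a (s : Finset ℝ≥0),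
      (fun ω (r : (insert a s : Finset ℝ≥0)) => X (t + r) ω - X t ω) =
        extendPath s a ∘ fun ω => ((fun r : s => X (t + r) ω - X t ω),
          X (t + a) ω - X (t + s.sup id) ω) := by
    intro t a s
    funext ω
    rw [Function.comp_apply, ← extendPath_eq (w := fun r => X (t + r) ω - X t ω) (by simp)]
    simp
  induction I using Finset.induction_on_max with
  | empty =>
    have : ∀ t, (fun ω (r : (∅ : Finset ℝ≥0)) => X (t + r) ω - X t ω) =
        fun _ => isEmptyElim := by
      intro t
      funext ω i
      exact isEmptyElim i
    simp_rw [this]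
    refine ⟨?_, trivial⟩
    rw [MeasurableSpace.comap_const]
    exact indep_bot_left _
  | insert a s hmax ih =>
    have hba : s.sup id ≤ a := sup_id_le hmax
    have hind : ∀ t, IndepFun (fun ω (r : s) => X (t + r) ω - X t ω)
        (fun ω => X (t + a) ω - X (t + s.sup id) ω) P := fun t =>
      indep_of_indep_of_le_left (hstep t a s hba).symm (hpast t s)
    constructor
    · have hsup := indep_sup_left (hm t s).comap_le (hmz (t + s.sup id) (t + a)).comap_le (F.le t)
        ih.1 (indep_of_indep_of_le_right (hstep t a s hba)
          (sup_le (hpast t s) (F.mono le_self_add)))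
      refine indep_of_indep_of_le_left hsup ?_
      rw [← MeasurableSpace.comap_prodMk, hext, ← MeasurableSpace.comap_comp]
      exact MeasurableSpace.comap_mono (measurable_extendPath s a).comap_le
    -- The new increment is independent of the earlier ones and has the law of `X (a - s.sup id)`,
    -- in which `t` does not occur.
    · have hlaw : ∀ t, P.map (fun ω (r : (insert a s : Finset ℝ≥0)) => X (t + r) ω - X t ω) =
          ((P.map fun ω (r : s) => X (t + r) ω - X t ω).prod
            (P.map (X (a - s.sup id)))).map (extendPath s a) := by
        intro t
        rw [hext, ← Measure.map_map (measurable_extendPath s a)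
          ((hm t s).prodMk (hmz _ _)), (indepFun_iff_map_prod_eq_prod_map_map
          (hm t s).aemeasurable (hmz _ _).aemeasurable).1 (hind t)]
        have := (hX.identDistrib_increment (t + s.sup id) (a - s.sup id)).map_eq
        rw [add_assoc, add_tsub_cancel_of_le hba] at this
        rw [this]
      rw [hlaw t, hlaw 0, ih.2]

theorem IsLevyProcess.indep_incrementsFrom (hX : IsLevyProcess F P X)
    (hc : ∀ ω, IsCadlag fun t => X t ω) (t : ℝ≥0) :
    Indep (MeasurableSpace.comap (incrementsFrom hc t) inferInstance) (F t) P := by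
  -- The σ-algebra `F t` is encoded as the one generated by the identity map into `Ω` with `F t`,
  -- which reduces the claim to finitely many coordinates.
  have hpi : @IndepFun _ _ _ mΩ _ (F t) (fun ω r => X (t + r) ω - X t ω) id P := by
    refine @IndepFun.process_indepFun _ _ _ _ _ _ _ (F t) _ _ (fun r =>
      (hX.measurable _).sub (hX.measurable _)) (measurable_id.mono (F.le t) le_rfl) (fun I => ?_) _
    change Indep _ (MeasurableSpace.comap id (F t)) P
    rw [MeasurableSpace.comap_id]
    exact (hX.finset_increments t I).1
  change Indep _ (MeasurableSpace.comap id (F t)) P at hpi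
  rw [MeasurableSpace.comap_id] at hpi
  refine indep_of_indep_of_le_left hpi ?_
  rw [Subtype.instMeasurableSpace, MeasurableSpace.comap_comp]
  exact le_rfl

theorem IsLevyProcess.map_incrementsFrom (hX : IsLevyProcess F P X)
    (hc : ∀ ω, IsCadlag fun t => X t ω) (t : ℝ≥0) :
    P.map (incrementsFrom hc t) = P.map (incrementsFrom hc 0) := by
  have hm : ∀ t, Measurable fun ω r => X (t + r) ω - X t ω := fun t =>
    measurable_pi_lambda _ fun _ => (hX.measurable _).sub (hX.measurable _)
  have hpi : P.map (fun ω r => X (t + r) ω - X t ω) = P.map fun ω r => X (0 + r) ω - X 0 ω :=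
    (map_eq_iff_forall_finset_map_restrict_eq (X := fun r ω => X (t + r) ω - X t ω)
      (Y := fun r ω => X (0 + r) ω - X 0 ω) (hm t).aemeasurable (hm 0).aemeasurable).2
      fun I => (hX.finset_increments t I).2
  ext A hA
  obtain ⟨A', hA', rfl⟩ := hA
  rw [Measure.map_apply (hX.measurable_incrementsFrom hc t) (measurable_subtype_coe hA'),
    Measure.map_apply (hX.measurable_incrementsFrom hc 0) (measurable_subtype_coe hA')]
  have := congrArg (fun μ => μ A') hpi
  simp only [Measure.map_apply (hm _) hA'] at this
  exact this

end IncrementPaths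

/-! ### Jump sums are Lévy processes, and their independence reduces to fixed times. -/

section JumpSumLevy

variable {Ω : Type*} {mΩ : MeasurableSpace Ω} {P : Measure Ω}
  {F : Filtration ℝ≥0 mΩ} {n : ℕ} {X : ℝ≥0 → Ω → EuclideanSpace ℝ (Fin n)}
  {h : EuclideanSpace ℝ (Fin n) → EuclideanSpace ℝ (Fin n)} {ε : ℝ}

/-- Measurability as a functional on path space is what carries independence and equality in law
from the increment path to jump sums. -/
theorem measurable_jumpSum_cadlagPath (hh : Measurable h) (hε : 0 < ε) (t : ℝ≥0) :
    Measurable fun f : CadlagPath n => jumpSum h ε f.1 t :=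
  (stronglyMeasurable_jumpSum (Y := fun s (f : CadlagPath n) => f.1 s) (fun f => f.2)
    (fun s _ => (measurable_pi_apply s).comp measurable_subtype_coe) hε
    hh.stronglyMeasurable).measurable

theorem jumpSum_add_sub (hc : ∀ ω, IsCadlag fun t => X t ω) (hε : 0 < ε) (t s : ℝ≥0) (ω : Ω) :
    jumpSum h ε (fun r => X r ω) (t + s) - jumpSum h ε (fun r => X r ω) t =
      jumpSum h ε (incrementsFrom hc t ω).1 s := by
  rw [(hc ω).jumpSum_add hε, add_sub_cancel_left]
  rfl

theorem jumpSum_incrementsFrom_zero (hc : ∀ ω, IsCadlag fun t => X t ω) (hε : 0 < ε) (s : ℝ≥0)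
    (ω : Ω) : jumpSum h ε (incrementsFrom hc 0 ω).1 s = jumpSum h ε (fun r => X r ω) s :=
  (hc ω).jumpSum_incrementPath_zero hε h s

theorem IsLevyProcess.adapted_jumpSum (hX : IsLevyProcess F P X)
    (hc : ∀ ω, IsCadlag fun t => X t ω) (hh : Measurable h) (hε : 0 < ε) (t : ℝ≥0) :
    Measurable[F t] fun ω => jumpSum h ε (fun r => X r ω) t :=
  (@stronglyMeasurable_jumpSum n Ω (F t) X t hc
    (fun s hs => (hX.adapted s).mono (F.mono hs) le_rfl) ε hε _ _ _ _ h
    hh.stronglyMeasurable).measurable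

theorem IsLevyProcess.measurable_jumpSum (hX : IsLevyProcess F P X)
    (hc : ∀ ω, IsCadlag fun t => X t ω) (hh : Measurable h) (hε : 0 < ε) (t : ℝ≥0) :
    Measurable fun ω => jumpSum h ε (fun r => X r ω) t :=
  (hX.adapted_jumpSum hc hh hε t).mono (F.le t) le_rfl

variable [IsProbabilityMeasure P]

theorem IsLevyProcess.identDistrib_jumpSum (hX : IsLevyProcess F P X)
    (hc : ∀ ω, IsCadlag fun t => X t ω) (hh : Measurable h) (hε : 0 < ε) (t s : ℝ≥0) :
    IdentDistrib (fun ω => jumpSum h ε (fun r => X r ω) (t + s) - jumpSum h ε (fun r => X r ω) t)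
      (fun ω => jumpSum h ε (fun r => X r ω) s) P P := by
  have hmeas := measurable_jumpSum_cadlagPath (n := n) hh hε s
  refine ⟨((hX.measurable_jumpSum hc hh hε _).sub (hX.measurable_jumpSum hc hh hε _)).aemeasurable,
    (hX.measurable_jumpSum hc hh hε _).aemeasurable, ?_⟩
  simp_rw [jumpSum_add_sub hc hε, ← jumpSum_incrementsFrom_zero hc hε s]
  have := congrArg (Measure.map fun f : CadlagPath n => jumpSum h ε f.1 s)
    (hX.map_incrementsFrom hc t)
  rwa [Measure.map_map hmeas (hX.measurable_incrementsFrom hc t),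
    Measure.map_map hmeas (hX.measurable_incrementsFrom hc 0)] at this

theorem comap_jumpSum_increment_le (hc : ∀ ω, IsCadlag fun t => X t ω) (hh : Measurable h)
    (hε : 0 < ε) (t s : ℝ≥0) :
    MeasurableSpace.comap (fun ω => jumpSum h ε (fun r => X r ω) (t + s) -
      jumpSum h ε (fun r => X r ω) t) inferInstance ≤
      MeasurableSpace.comap (incrementsFrom hc t) inferInstance := by
  simp_rw [jumpSum_add_sub hc hε]
  rw [← Function.comp_def (fun f : CadlagPath n => jumpSum h ε f.1 s) (incrementsFrom hc t),
    ← MeasurableSpace.comap_comp]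
  exact MeasurableSpace.comap_mono (measurable_jumpSum_cadlagPath hh hε s).comap_le

/-- Stationarity of the increments moves the question to time `0`, near which every path of the jump
sum vanishes. -/
theorem IsLevyProcess.tendstoInMeasure_jumpSum (hX : IsLevyProcess F P X)
    (hc : ∀ ω, IsCadlag fun t => X t ω) (hh : Measurable h) (hε : 0 < ε) (t : ℝ≥0) :
    TendstoInMeasure P (fun s ω => jumpSum h ε (fun r => X r ω) s) (𝓝 t)
      (fun ω => jumpSum h ε (fun r => X r ω) t) := by
  intro η hη
  have hset : MeasurableSet {x : EuclideanSpace ℝ (Fin n) | η ≤ edist x 0} :=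
    measurableSet_le measurable_const (measurable_id.edist measurable_const)
  have hzero : Tendsto (fun d => P {ω | η ≤ edist (jumpSum h ε (fun r => X r ω) d) 0}) (𝓝 0)
      (𝓝 0) := by
    -- Sequences are needed because convergence almost everywhere implies convergence in measure
    -- along sequences.
    refine tendsto_of_seq_tendsto fun d hd => ?_
    refine tendstoInMeasure_of_tendsto_ae (g := fun _ => 0)
      (fun k => (hX.measurable_jumpSum hc hh hε (d k)).aestronglyMeasurable)
      (ae_of_all _ fun ω => ?_) η hη
    exact tendsto_const_nhds.congr' (hd.eventually ((hc ω).eventually_jumpSum_eq_zero hε h)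
      |>.mono fun _ hk => hk.symm)
  have hsame : ∀ a b : ℝ≥0, a ≤ b → P {ω | η ≤ edist (jumpSum h ε (fun r => X r ω) b)
      (jumpSum h ε (fun r => X r ω) a)} =
      P {ω | η ≤ edist (jumpSum h ε (fun r => X r ω) (b - a)) 0} := by
    intro a b hab
    have := (hX.identDistrib_jumpSum hc hh hε a (b - a)).measure_mem_eq hset
    rw [add_tsub_cancel_of_le hab] at this
    have hpre : {ω | η ≤ edist (jumpSum h ε (fun r => X r ω) b) (jumpSum h ε (fun r => X r ω) a)} =
        (fun ω => jumpSum h ε (fun r => X r ω) b - jumpSum h ε (fun r => X r ω) a) ⁻¹'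
          {x | η ≤ edist x 0} := by
      ext ω
      simp [edist_eq_enorm_sub]
    rw [hpre]
    exact this
  have hdist : Tendsto (fun s => nndist s t) (𝓝 t) (𝓝 0) := by
    simpa using (continuous_id.nndist continuous_const).tendsto (f := fun s => nndist s t) t
  refine (hzero.comp hdist).congr fun s => ?_
  rw [Function.comp_apply]
  rcases le_total t s with hts | hts
  · have hd : nndist s t = s - t := by
      rw [← NNReal.coe_inj, coe_nndist, NNReal.dist_eq, NNReal.coe_sub hts,
        abs_of_nonneg (sub_nonneg.2 (NNReal.coe_le_coe.2 hts))]
    rw [hsame t s hts, hd]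
  · have hd : nndist s t = t - s := by
      rw [← NNReal.coe_inj, coe_nndist, NNReal.dist_eq, NNReal.coe_sub hts,
        abs_of_nonpos (sub_nonpos.2 (NNReal.coe_le_coe.2 hts)), neg_sub]
    simp_rw [edist_comm (jumpSum h ε _ s)]
    rw [hsame s t hts, hd]

theorem IsLevyProcess.isLevyProcess_jumpSum (hX : IsLevyProcess F P X)
    (hc : ∀ ω, IsCadlag fun t => X t ω)
    (hh : Measurable h) (hε : 0 < ε) :
    IsLevyProcess F P fun t ω => jumpSum h ε (fun r => X r ω) t where
  adapted := hX.adapted_jumpSum hc hh hε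
  zero := ae_of_all _ fun _ => jumpSum_time_zero h ε
  indep_increment t s := indep_of_indep_of_le_left (hX.indep_incrementsFrom hc t)
    (comap_jumpSum_increment_le hc hh hε t s)
  identDistrib_increment := hX.identDistrib_jumpSum hc hh hε
  continuous_in_probability := hX.tendstoInMeasure_jumpSum hc hh hε

/-- The sums of two functions over the jumps are independent as processes if they are independent
at each fixed time. -/
theorem IsLevyProcess.indepFun_jumpSum_of_forall (hX : IsLevyProcess F P X)
    (hc : ∀ ω, IsCadlag fun t => X t ω) {g : EuclideanSpace ℝ (Fin n) → EuclideanSpace ℝ (Fin n)}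
    (hh : Measurable h) (hg : Measurable g) (hε : 0 < ε)
    (hind : ∀ s, IndepFun (fun ω => jumpSum h ε (fun r => X r ω) s)
      (fun ω => jumpSum g ε (fun r => X r ω) s) P) :
    IndepFun (fun ω t => jumpSum h ε (fun r => X r ω) t)
      (fun ω t => jumpSum g ε (fun r => X r ω) t) P := by
  refine indepFun_of_indep_increments F (hX.adapted_jumpSum hc hh hε) (hX.adapted_jumpSum hc hg hε)
    (fun _ => jumpSum_time_zero h ε) (fun _ => jumpSum_time_zero g ε) (fun t s => ?_) fun t s => ?_
  · exact indep_of_indep_of_le_left (hX.indep_incrementsFrom hc t)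
      (sup_le (comap_jumpSum_increment_le hc hh hε t s) (comap_jumpSum_increment_le hc hg hε t s))
  · have hmh := measurable_jumpSum_cadlagPath (n := n) hh hε s
    have hmg := measurable_jumpSum_cadlagPath (n := n) hg hε s
    have hi := hind s
    simp_rw [← jumpSum_incrementsFrom_zero hc hε s] at hi
    simp_rw [jumpSum_add_sub hc hε]
    have hm := hX.measurable_incrementsFrom hc
    have mh : ∀ t, AEMeasurable
        (fun ω => jumpSum h ε (incrementsFrom hc t ω).1 s) P := fun t =>
      (hmh.comp (hm t)).aemeasurable
    have mg : ∀ t, AEMeasurable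
        (fun ω => jumpSum g ε (incrementsFrom hc t ω).1 s) P := fun t =>
      (hmg.comp (hm t)).aemeasurable
    rw [indepFun_iff_map_prod_eq_prod_map_map (mh 0) (mg 0)] at hi
    rw [indepFun_iff_map_prod_eq_prod_map_map (mh t) (mg t)]
    have e1 : ∀ t, P.map (fun ω => jumpSum h ε (incrementsFrom hc t ω).1 s) =
        (P.map (incrementsFrom hc t)).map fun f => jumpSum h ε f.1 s := fun t =>
      (Measure.map_map hmh (hm t)).symm
    have e2 : ∀ t, P.map (fun ω => jumpSum g ε (incrementsFrom hc t ω).1 s) =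
        (P.map (incrementsFrom hc t)).map fun f => jumpSum g ε f.1 s := fun t =>
      (Measure.map_map hmg (hm t)).symm
    have e3 : ∀ t, P.map (fun ω => (jumpSum h ε (incrementsFrom hc t ω).1 s,
        jumpSum g ε (incrementsFrom hc t ω).1 s)) =
        (P.map (incrementsFrom hc t)).map fun f => (jumpSum h ε f.1 s,
          jumpSum g ε f.1 s) := fun t =>
      (Measure.map_map (hmh.prodMk hmg) (hm t)).symm
    rw [e1, e2, e3] at hi ⊢
    rwa [hX.map_incrementsFrom hc t]

end JumpSumLevy

/-! ### Factorization at a fixed time for continuous functions. -/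

section FixedTime

open Complex

theorem norm_pow_sub_pow_le_mul {a b : ℂ} (ha : ‖a‖ ≤ 1) (hb : ‖b‖ ≤ 1) (N : ℕ) :
    ‖a ^ N - b ^ N‖ ≤ N * ‖a - b‖ := by
  induction N with
  | zero => simp
  | succ N ih =>
    have h1 : a ^ (N + 1) - b ^ (N + 1) = a * (a ^ N - b ^ N) + (a - b) * b ^ N := by ring
    have h2 : ‖a * (a ^ N - b ^ N)‖ ≤ N * ‖a - b‖ := by
      rw [norm_mul]
      exact (mul_le_of_le_one_left (norm_nonneg _) ha).trans ih
    have h3 : ‖(a - b) * b ^ N‖ ≤ ‖a - b‖ := by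
      rw [norm_mul, norm_pow]
      exact mul_le_of_le_one_right (norm_nonneg _) (pow_le_one₀ (norm_nonneg _) hb)
    calc ‖a ^ (N + 1) - b ^ (N + 1)‖ ≤ ‖a * (a ^ N - b ^ N)‖ + ‖(a - b) * b ^ N‖ := by
          rw [h1]
          exact norm_add_le _ _
      _ ≤ (N + 1 : ℕ) * ‖a - b‖ := by
          push_cast
          linarith

theorem norm_exp_le_one {z : ℂ} (hz : z.re ≤ 0) : ‖exp z‖ ≤ 1 := by
  rw [Complex.norm_exp]
  exact Real.exp_le_one_iff.2 hz

/-- If powers `(1 - q m) ^ (m + 1)` have a positive limit, then `q m` is of order `1 / m`. -/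
theorem tendsto_mul_sq_of_tendsto_pow {q : ℕ → ℝ} (hq0 : ∀ m, 0 ≤ q m) (hq1 : ∀ m, q m ≤ 1)
    {c : ℝ} (hc : 0 < c) (hlim : Tendsto (fun m => (1 - q m) ^ (m + 1)) atTop (𝓝 c)) :
    Tendsto (fun m : ℕ => (m + 1 : ℝ) * q m ^ 2) atTop (𝓝 0) := by
  set L : ℝ := -Real.log (c / 2) with hL
  -- From `1 - q ≤ exp (-q)`, eventually `c / 2 < (1 - q m) ^ (m + 1) ≤ exp (-(m + 1) * q m)`; take
  -- logarithms.
  have hbd : ∀ᶠ m : ℕ in atTop, (m + 1 : ℝ) * q m ≤ L := by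
    filter_upwards [hlim.eventually (lt_mem_nhds (half_lt_self hc))] with m hm
    have h1 : (1 - q m) ^ (m + 1) ≤ Real.exp (-((m + 1 : ℝ) * q m)) := by
      calc (1 - q m) ^ (m + 1) ≤ Real.exp (-q m) ^ (m + 1) :=
            pow_le_pow_left₀ (sub_nonneg.2 (hq1 m)) (Real.one_sub_le_exp_neg _) _
        _ = Real.exp (-((m + 1 : ℝ) * q m)) := by
            rw [← Real.exp_nat_mul]
            push_cast
            ring_nf
    have h2 := Real.log_le_log (half_pos hc) (hm.le.trans h1)
    rw [Real.log_exp] at h2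
    linarith
  have hdiv : Tendsto (fun m : ℕ => L ^ 2 * (1 / ((m : ℝ) + 1))) atTop (𝓝 0) := by
    simpa using (tendsto_one_div_add_atTop_nhds_zero_nat (𝕜 := ℝ)).const_mul (L ^ 2)
  refine squeeze_zero' (Eventually.of_forall fun m => by positivity) ?_ hdiv
  filter_upwards [hbd] with m hm
  have hm1 : (0 : ℝ) < m + 1 := by positivity
  have h3 : ((m + 1 : ℝ) * q m) ^ 2 ≤ L ^ 2 :=
    pow_le_pow_left₀ (mul_nonneg hm1.le (hq0 m)) hm 2
  calc (m + 1 : ℝ) * q m ^ 2 = ((m + 1 : ℝ) * q m) ^ 2 * (1 / ((m : ℝ) + 1)) := by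
        field_simp
    _ ≤ L ^ 2 * (1 / ((m : ℝ) + 1)) := by gcongr

variable {Ω : Type*} {mΩ : MeasurableSpace Ω} {P : Measure Ω}
  {F : Filtration ℝ≥0 mΩ} {n : ℕ} {X : ℝ≥0 → Ω → EuclideanSpace ℝ (Fin n)}
  {k k₁ k₂ : EuclideanSpace ℝ (Fin n) → ℂ} {ε : ℝ}

theorem re_jumpSum_nonpos {f : ℝ≥0 → EuclideanSpace ℝ (Fin n)} (hf : IsCadlag f) (hε : 0 < ε)
    (t : ℝ≥0) (hk : ∀ x, (k x).re ≤ 0) : (jumpSum k ε f t).re ≤ 0 := by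
  rw [hf.jumpSum_eq_sum hε, Complex.re_sum]
  exact Finset.sum_nonpos fun s _ => hk _

theorem IsCadlag.jumpSum_fun_add {f : ℝ≥0 → EuclideanSpace ℝ (Fin n)} (hf : IsCadlag f)
    (hε : 0 < ε) (t : ℝ≥0) :
    jumpSum (fun x => k₁ x + k₂ x) ε f t = jumpSum k₁ ε f t + jumpSum k₂ ε f t := by
  simp_rw [hf.jumpSum_eq_sum hε, Finset.sum_add_distrib]

theorem IsLevyProcess.measurable_jumpSum_complex (hX : IsLevyProcess F P X)
    (hc : ∀ ω, IsCadlag fun t => X t ω) (hk : Measurable k) (hε : 0 < ε) (t : ℝ≥0) :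
    Measurable fun ω => jumpSum k ε (fun s => X s ω) t :=
  (stronglyMeasurable_jumpSum hc (fun s _ => hX.measurable s) hε hk.stronglyMeasurable).measurable

variable [IsProbabilityMeasure P]

theorem IsLevyProcess.integral_prod_increments (hX : IsLevyProcess F P X)
    {g : EuclideanSpace ℝ (Fin n) → ℂ} (hg : Measurable g) (t : ℝ≥0) (m j : ℕ) :
    ∫ ω, ∏ i ∈ Finset.range j, g (X (grid t m (i + 1)) ω - X (grid t m i) ω) ∂P =
      (∫ ω, g (X (t / (m + 1)) ω) ∂P) ^ j := by
  have hinc : ∀ i, Measurable fun ω => g (X (grid t m (i + 1)) ω - X (grid t m i) ω) := fun i =>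
    hg.comp ((hX.measurable _).sub (hX.measurable _))
  induction j with
  | zero => simp
  | succ j ih =>
    simp_rw [Finset.prod_range_succ]
    have hpast : Measurable[F (grid t m j)] fun ω =>
        ∏ i ∈ Finset.range j, g (X (grid t m (i + 1)) ω - X (grid t m i) ω) := by
      refine Finset.measurable_fun_prod _ fun i hi => hg.comp ?_
      have hij : i + 1 ≤ j := Finset.mem_range.1 hi
      exact ((hX.adapted _).mono (F.mono (grid_mono t m hij)) le_rfl).sub
        ((hX.adapted _).mono (F.mono (grid_mono t m (i.le_succ.trans hij))) le_rfl)
    have hnext := hX.indep_increment (grid t m j) (t / (m + 1))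
    rw [← grid_succ] at hnext
    have hind : IndepFun
        (fun ω => ∏ i ∈ Finset.range j, g (X (grid t m (i + 1)) ω - X (grid t m i) ω))
        (fun ω => g (X (grid t m (j + 1)) ω - X (grid t m j) ω)) P := by
      refine indep_of_indep_of_le hnext.symm hpast.comap_le ?_
      rw [← Function.comp_def g, ← MeasurableSpace.comap_comp]
      exact MeasurableSpace.comap_mono hg.comap_le
    rw [hind.integral_fun_mul_eq_mul_integral
      (Finset.measurable_fun_prod _ fun i _ => hinc i).aestronglyMeasurable
      (hinc j).aestronglyMeasurable, ih, pow_succ]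
    have hid := (hX.identDistrib_increment (grid t m j) (t / (m + 1))).comp hg
    rw [← grid_succ] at hid
    exact congrArg _ hid.integral_eq

/-- The power is the expectation of `exp` of the sum of `k` over the grid increments, which are
independent and identically distributed. Nonpositive real parts bound the integrand by `1`, so
dominated convergence applies. -/
theorem IsLevyProcess.tendsto_integral_pow (hX : IsLevyProcess F P X)
    (hc : ∀ ω, IsCadlag fun t => X t ω) (hε : 0 < ε) (t : ℝ≥0) (hk : Continuous k)
    (hk0 : ∀ x, ‖x‖ < ε → k x = 0) (hre : ∀ x, (k x).re ≤ 0) :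
    Tendsto (fun m : ℕ => (∫ ω, exp (k (X (t / (m + 1)) ω)) ∂P) ^ (m + 1)) atTop
      (𝓝 (∫ ω, exp (jumpSum k ε (fun s => X s ω) t) ∂P)) := by
  have hek : Measurable fun x => exp (k x) := (continuous_exp.comp hk).measurable
  simp_rw [← hX.integral_prod_increments hek t, ← Complex.exp_sum]
  refine tendsto_integral_of_dominated_convergence (fun _ => 1) (fun m => ?_)
    (integrable_const _) (fun m => ae_of_all _ fun ω => norm_exp_le_one ?_)
    (ae_of_all _ fun ω => (continuous_exp.tendsto _).comp
      ((hc ω).tendsto_sum_increments hε t hk hk0))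
  · refine (Complex.measurable_exp.comp (Finset.measurable_fun_sum _ fun i _ =>
      hk.measurable.comp ?_)).aestronglyMeasurable
    exact (hX.measurable _).sub (hX.measurable _)
  · rw [Complex.re_sum]
    exact Finset.sum_nonpos fun i _ => hre _

/-- The Laplace transforms of the sums over the jumps of two continuous functions that have
disjoint supports and vanish near `0` factorize. -/
theorem IsLevyProcess.integral_exp_jumpSum_of_continuous (hX : IsLevyProcess F P X)
    (hc : ∀ ω, IsCadlag fun t => X t ω) (hε : 0 < ε) (t : ℝ≥0) (hk₁ : Continuous k₁)
    (hk₂ : Continuous k₂) (h0₁ : ∀ x, ‖x‖ < ε → k₁ x = 0) (h0₂ : ∀ x, ‖x‖ < ε → k₂ x = 0)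
    (hre₁ : ∀ x, (k₁ x).re ≤ 0) (hre₂ : ∀ x, (k₂ x).re ≤ 0) (hdisj : ∀ x, k₁ x = 0 ∨ k₂ x = 0) :
    ∫ ω, exp (jumpSum k₁ ε (fun s => X s ω) t + jumpSum k₂ ε (fun s => X s ω) t) ∂P =
      (∫ ω, exp (jumpSum k₁ ε (fun s => X s ω) t) ∂P) *
        ∫ ω, exp (jumpSum k₂ ε (fun s => X s ω) t) ∂P := by
  have hlim₁ := hX.tendsto_integral_pow hc hε t hk₁ h0₁ hre₁
  have hlim₂ := hX.tendsto_integral_pow hc hε t hk₂ h0₂ hre₂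
  have hlim₃ := hX.tendsto_integral_pow hc hε t (hk₁.add hk₂)
    (fun x hx => by rw [Pi.add_apply, h0₁ x hx, h0₂ x hx, add_zero])
    (fun x => by rw [Pi.add_apply, add_re]; linarith [hre₁ x, hre₂ x])
  have hadd : ∀ ω, jumpSum (k₁ + k₂) ε (fun s => X s ω) t =
      jumpSum k₁ ε (fun s => X s ω) t + jumpSum k₂ ε (fun s => X s ω) t := fun ω =>
    (hc ω).jumpSum_fun_add hε t
  simp_rw [hadd] at hlim₃
  -- a bump function that controls the probability of an increment of size at least `ε`
  set φ : EuclideanSpace ℝ (Fin n) → ℝ := fun x => max 0 (min 1 (2 * ‖x‖ / ε - 1)) with hφ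
  have hφc : Continuous φ := by
    rw [hφ]
    fun_prop
  have hφ0 : ∀ x, ‖x‖ < ε / 2 → φ x = 0 := fun x hx => by
    refine max_eq_left ((min_le_right _ _).trans ?_)
    rw [sub_nonpos, div_le_one hε]
    linarith
  have hφ1 : ∀ x, ε ≤ ‖x‖ → φ x = 1 := fun x hx => by
    have : (1 : ℝ) ≤ 2 * ‖x‖ / ε - 1 := by
      rw [le_sub_iff_add_le, le_div_iff₀ hε]
      linarith
    rw [hφ]
    simp [min_eq_left this]
  have hφnn : ∀ x, 0 ≤ φ x := fun x => le_max_left _ _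
  have hlim₄ := hX.tendsto_integral_pow hc (half_pos hε) t (k := fun x => ((-φ x : ℝ) : ℂ))
    (continuous_ofReal.comp hφc.neg) (fun x hx => by simp [hφ0 x hx])
    (fun x => by simpa using hφnn x)
  have hreal : ∀ ω, jumpSum (fun x => ((-φ x : ℝ) : ℂ)) (ε / 2) (fun s => X s ω) t =
      ((jumpSum (fun x => -φ x) (ε / 2) (fun s => X s ω) t : ℝ) : ℂ) := fun ω => by
    rw [(hc ω).jumpSum_eq_sum (half_pos hε), (hc ω).jumpSum_eq_sum (half_pos hε), ofReal_sum]
  simp_rw [hreal, ← ofReal_exp, integral_complex_ofReal, ← ofReal_pow] at hlim₄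
  rw [tendsto_ofReal_iff] at hlim₄
  have hSm : Measurable fun ω => jumpSum (fun x => -φ x) (ε / 2) (fun s => X s ω) t :=
    (stronglyMeasurable_jumpSum hc (fun s _ => hX.measurable s) (half_pos hε)
      hφc.neg.measurable.stronglyMeasurable).measurable
  have hSle : ∀ ω, jumpSum (fun x => -φ x) (ε / 2) (fun s => X s ω) t ≤ 0 := fun ω => by
    rw [(hc ω).jumpSum_eq_sum (half_pos hε)]
    exact Finset.sum_nonpos fun s _ => neg_nonpos.2 (hφnn _)
  have hint : ∀ Z : Ω → ℝ, Measurable Z → (∀ ω, Z ω ≤ 0) →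
      Integrable (fun ω => Real.exp (Z ω)) P := fun Z hZ hZ0 =>
    Integrable.of_bound (Real.measurable_exp.comp hZ).aestronglyMeasurable 1
      (ae_of_all _ fun ω => by
        rw [Real.norm_eq_abs, Real.abs_exp]
        exact Real.exp_le_one_iff.2 (hZ0 ω))
  -- Jump sums are finite, so the limit of `(1 - q m) ^ (m + 1)` is positive; this forces `q m` to
  -- be of order `1 / m`.
  have hcpos : 0 < ∫ ω, Real.exp (jumpSum (fun x => -φ x) (ε / 2) (fun s => X s ω) t) ∂P :=
    integral_exp_pos (hint _ hSm hSle)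
  set Y : ℕ → Ω → EuclideanSpace ℝ (Fin n) := fun m => X (t / (m + 1)) with hY
  have hYm : ∀ m, Measurable (Y m) := fun m => hX.measurable _
  have hYint : ∀ m, Integrable (fun ω => Real.exp (-φ (Y m ω))) P := fun m =>
    hint _ (hφc.measurable.comp (hYm m)).neg fun ω => neg_nonpos.2 (hφnn _)
  set q : ℕ → ℝ := fun m => ∫ ω, (1 - Real.exp (-φ (Y m ω))) ∂P with hq
  have hqeq : ∀ m, 1 - q m = ∫ ω, Real.exp (-φ (Y m ω)) ∂P := fun m => by
    rw [hq]
    simp only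
    rw [integral_sub (integrable_const _) (hYint m)]
    simp
  have hexple : ∀ x, Real.exp (-φ x) ≤ 1 := fun x => Real.exp_le_one_iff.2 (neg_nonpos.2 (hφnn x))
  have hq0 : ∀ m, 0 ≤ q m := fun m => integral_nonneg fun ω => sub_nonneg.2 (hexple _)
  have hq1 : ∀ m, q m ≤ 1 := fun m => by
    have : 0 ≤ ∫ ω, Real.exp (-φ (Y m ω)) ∂P := integral_nonneg fun ω => (Real.exp_pos _).le
    linarith [hqeq m]
  have hsq := tendsto_mul_sq_of_tendsto_pow hq0 hq1 hcpos (by simpa only [hqeq] using hlim₄)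
  -- Where `‖Y m ω‖ ≥ ε` one has `φ = 1`, and `C * (1 - exp (-1)) = 2` dominates `‖1 - exp (k (Y m
  -- ω))‖`; elsewhere `k` vanishes.
  set C : ℝ := 2 / (1 - Real.exp (-1)) with hC
  have hC1 : 0 < 1 - Real.exp (-1) := sub_pos.2 (Real.exp_lt_one_iff.2 (by norm_num))
  have hCpos : 0 < C := by positivity
  have hbound : ∀ k : EuclideanSpace ℝ (Fin n) → ℂ, Continuous k → (∀ x, ‖x‖ < ε → k x = 0) →
      (∀ x, (k x).re ≤ 0) → ∀ m, Integrable (fun ω => exp (k (Y m ω))) P ∧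
        ‖1 - ∫ ω, exp (k (Y m ω)) ∂P‖ ≤ C * q m := by
    intro k hk h0 hre m
    have hi : Integrable (fun ω => exp (k (Y m ω))) P :=
      Integrable.of_bound ((continuous_exp.comp hk).measurable.comp (hYm m)).aestronglyMeasurable 1
        (ae_of_all _ fun ω => norm_exp_le_one (hre _))
    refine ⟨hi, ?_⟩
    have h1 : 1 - ∫ ω, exp (k (Y m ω)) ∂P = ∫ ω, (1 - exp (k (Y m ω))) ∂P := by
      rw [integral_sub (integrable_const _) hi]
      simp
    rw [h1, hq, ← integral_const_mul]
    refine norm_integral_le_of_norm_le (((integrable_const _).sub (hYint m)).const_mul C)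
      (ae_of_all _ fun ω => ?_)
    rcases lt_or_ge ‖Y m ω‖ ε with hlt | hge
    · rw [h0 _ hlt]
      simpa using mul_nonneg hCpos.le (sub_nonneg.2 (hexple (Y m ω)))
    · rw [hφ1 _ hge, hC, div_mul_cancel₀ _ hC1.ne']
      calc ‖1 - exp (k (Y m ω))‖ ≤ ‖(1 : ℂ)‖ + ‖exp (k (Y m ω))‖ := norm_sub_le _ _
        _ ≤ 2 := by
          rw [norm_one]
          linarith [norm_exp_le_one (hre (Y m ω))]
  have hnorm : ∀ k : EuclideanSpace ℝ (Fin n) → ℂ, (∀ x, (k x).re ≤ 0) → ∀ m,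
      ‖∫ ω, exp (k (Y m ω)) ∂P‖ ≤ 1 := fun k hre m =>
    (norm_integral_le_of_norm_le_const (ae_of_all _ fun ω => norm_exp_le_one (hre (Y m ω)))).trans
      (by simp)
  -- At each point one of the two exponentials equals `1`.
  have hsplit : ∀ m, ∫ ω, exp ((k₁ + k₂) (Y m ω)) ∂P =
      (∫ ω, exp (k₁ (Y m ω)) ∂P) + (∫ ω, exp (k₂ (Y m ω)) ∂P) - 1 := fun m => by
    have h1 := (hbound k₁ hk₁ h0₁ hre₁ m).1
    have h2 := (hbound k₂ hk₂ h0₂ hre₂ m).1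
    have : ∀ ω, exp ((k₁ + k₂) (Y m ω)) = exp (k₁ (Y m ω)) + exp (k₂ (Y m ω)) - 1 := fun ω => by
      rcases hdisj (Y m ω) with h | h <;> simp [h]
    simp_rw [this]
    have h12 : Integrable (fun ω => exp (k₁ (Y m ω)) + exp (k₂ (Y m ω))) P := h1.add h2
    rw [integral_sub h12 (integrable_const _), integral_add h1 h2]
    simp
  have hdiff : Tendsto (fun m : ℕ => (∫ ω, exp ((k₁ + k₂) (Y m ω)) ∂P) ^ (m + 1) -
      ((∫ ω, exp (k₁ (Y m ω)) ∂P) * ∫ ω, exp (k₂ (Y m ω)) ∂P) ^ (m + 1)) atTop (𝓝 0) := by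
    refine squeeze_zero_norm (fun m => ?_) (by simpa using hsq.const_mul (C ^ 2))
    refine (norm_pow_sub_pow_le_mul (hnorm _ (fun x => by
      rw [Pi.add_apply, add_re]; linarith [hre₁ x, hre₂ x]) m) ?_ (m + 1)).trans ?_
    · rw [norm_mul]
      exact mul_le_one₀ (hnorm _ hre₁ m) (norm_nonneg _) (hnorm _ hre₂ m)
    · have h1 := (hbound k₁ hk₁ h0₁ hre₁ m).2
      have h2 := (hbound k₂ hk₂ h0₂ hre₂ m).2
      have h3 : (∫ ω, exp ((k₁ + k₂) (Y m ω)) ∂P) -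
          (∫ ω, exp (k₁ (Y m ω)) ∂P) * ∫ ω, exp (k₂ (Y m ω)) ∂P =
          -((1 - ∫ ω, exp (k₁ (Y m ω)) ∂P) * (1 - ∫ ω, exp (k₂ (Y m ω)) ∂P)) := by
        rw [hsplit]
        ring
      rw [h3, norm_neg, norm_mul]
      push_cast
      calc ((m : ℝ) + 1) * (‖1 - ∫ ω, exp (k₁ (Y m ω)) ∂P‖ * ‖1 - ∫ ω, exp (k₂ (Y m ω)) ∂P‖)
          ≤ ((m : ℝ) + 1) * ((C * q m) * (C * q m)) := by
            gcongr
            exact mul_nonneg hCpos.le (hq0 m)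
        _ = C ^ 2 * (((m : ℝ) + 1) * q m ^ 2) := by ring
  have hprod := hlim₁.mul hlim₂
  simp_rw [← mul_pow] at hprod
  have := tendsto_nhds_unique hdiff (hlim₃.sub hprod)
  exact (sub_eq_zero.1 this.symm)

end FixedTime

/-! ### From continuous functions to disjoint Borel sets, and independence at a fixed time. -/

section FixedTimeIndependence

open Complex

variable {Ω : Type*} {mΩ : MeasurableSpace Ω} {P : Measure Ω} [IsProbabilityMeasure P]
  {F : Filtration ℝ≥0 mΩ} {n : ℕ} {X : ℝ≥0 → Ω → EuclideanSpace ℝ (Fin n)} {ε : ℝ}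

/-- The factorization of the Laplace transforms is stable under limits along the jumps. -/
theorem IsLevyProcess.integral_exp_jumpSum_of_tendsto (hX : IsLevyProcess F P X)
    (hc : ∀ ω, IsCadlag fun t => X t ω) (hε : 0 < ε) (t : ℝ≥0)
    {k₁ k₂ : ℕ → EuclideanSpace ℝ (Fin n) → ℂ} {k₁' k₂' : EuclideanSpace ℝ (Fin n) → ℂ}
    (hm₁ : ∀ j, Measurable (k₁ j)) (hm₂ : ∀ j, Measurable (k₂ j))
    (hre₁ : ∀ j x, (k₁ j x).re ≤ 0) (hre₂ : ∀ j x, (k₂ j x).re ≤ 0)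
    (hlim₁ : ∀ᵐ ω ∂P, ∀ s ∈ bigJumps (fun s => X s ω) ε t,
      Tendsto (fun j => k₁ j (jump (fun s => X s ω) s)) atTop (𝓝 (k₁' (jump (fun s => X s ω) s))))
    (hlim₂ : ∀ᵐ ω ∂P, ∀ s ∈ bigJumps (fun s => X s ω) ε t,
      Tendsto (fun j => k₂ j (jump (fun s => X s ω) s)) atTop (𝓝 (k₂' (jump (fun s => X s ω) s))))
    (hfac : ∀ j, ∫ ω, exp (jumpSum (k₁ j) ε (fun s => X s ω) t +
        jumpSum (k₂ j) ε (fun s => X s ω) t) ∂P =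
      (∫ ω, exp (jumpSum (k₁ j) ε (fun s => X s ω) t) ∂P) *
        ∫ ω, exp (jumpSum (k₂ j) ε (fun s => X s ω) t) ∂P) :
    ∫ ω, exp (jumpSum k₁' ε (fun s => X s ω) t + jumpSum k₂' ε (fun s => X s ω) t) ∂P =
      (∫ ω, exp (jumpSum k₁' ε (fun s => X s ω) t) ∂P) *
        ∫ ω, exp (jumpSum k₂' ε (fun s => X s ω) t) ∂P := by
  have hs₁ := fun j => hX.measurable_jumpSum_complex hc (hm₁ j) hε t
  have hs₂ := fun j => hX.measurable_jumpSum_complex hc (hm₂ j) hε t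
  have hn₁ := fun j ω => re_jumpSum_nonpos (hc ω) hε t (hre₁ j)
  have hn₂ := fun j ω => re_jumpSum_nonpos (hc ω) hε t (hre₂ j)
  have hl₁ : ∀ᵐ ω ∂P, Tendsto (fun j => jumpSum (k₁ j) ε (fun s => X s ω) t) atTop
      (𝓝 (jumpSum k₁' ε (fun s => X s ω) t)) := by
    filter_upwards [hlim₁] with ω hω using (hc ω).tendsto_jumpSum hε hω
  have hl₂ : ∀ᵐ ω ∂P, Tendsto (fun j => jumpSum (k₂ j) ε (fun s => X s ω) t) atTop
      (𝓝 (jumpSum k₂' ε (fun s => X s ω) t)) := by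
    filter_upwards [hlim₂] with ω hω using (hc ω).tendsto_jumpSum hε hω
  have hdct : ∀ {Z : ℕ → Ω → ℂ} {Z' : Ω → ℂ}, (∀ j, Measurable (Z j)) →
      (∀ j ω, (Z j ω).re ≤ 0) → (∀ᵐ ω ∂P, Tendsto (fun j => Z j ω) atTop (𝓝 (Z' ω))) →
      Tendsto (fun j => ∫ ω, exp (Z j ω) ∂P) atTop (𝓝 (∫ ω, exp (Z' ω) ∂P)) := by
    intro Z Z' hZ hZn hZl
    refine tendsto_integral_of_dominated_convergence (fun _ => 1)
      (fun j => (Complex.measurable_exp.comp (hZ j)).aestronglyMeasurable) (integrable_const _)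
      (fun j => ae_of_all _ fun ω => norm_exp_le_one (hZn j ω)) ?_
    filter_upwards [hZl] with ω hω using (continuous_exp.tendsto _).comp hω
  have h3 := hdct (Z := fun j ω => jumpSum (k₁ j) ε (fun s => X s ω) t +
      jumpSum (k₂ j) ε (fun s => X s ω) t)
    (Z' := fun ω => jumpSum k₁' ε (fun s => X s ω) t + jumpSum k₂' ε (fun s => X s ω) t)
    (fun j => (hs₁ j).add (hs₂ j))
    (fun j ω => by rw [add_re]; exact add_nonpos (hn₁ j ω) (hn₂ j ω))
    (by filter_upwards [hl₁, hl₂] with ω h1 h2 using h1.add h2)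
  refine tendsto_nhds_unique h3 ?_
  simp_rw [hfac]
  exact (hdct hs₁ hn₁ hl₁).mul (hdct hs₂ hn₂ hl₂)

theorem IsLevyProcess.integral_exp_jumpSum_of_isCompact (hX : IsLevyProcess F P X)
    (hc : ∀ ω, IsCadlag fun t => X t ω) (hε : 0 < ε) (t : ℝ≥0)
    {k₁ k₂ : EuclideanSpace ℝ (Fin n) → ℂ} (hk₁ : Continuous k₁) (hk₂ : Continuous k₂)
    (hre₁ : ∀ x, (k₁ x).re ≤ 0) (hre₂ : ∀ x, (k₂ x).re ≤ 0)
    {K₁ K₂ : Set (EuclideanSpace ℝ (Fin n))} (hK₁ : IsCompact K₁) (hK₂ : IsCompact K₂)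
    (hK₁ε : ∀ x ∈ K₁, 2 * ε ≤ ‖x‖) (hK₂ε : ∀ x ∈ K₂, 2 * ε ≤ ‖x‖) (hdisj : Disjoint K₁ K₂) :
    ∫ ω, exp (jumpSum (K₁.indicator k₁) ε (fun s => X s ω) t +
        jumpSum (K₂.indicator k₂) ε (fun s => X s ω) t) ∂P =
      (∫ ω, exp (jumpSum (K₁.indicator k₁) ε (fun s => X s ω) t) ∂P) *
        ∫ ω, exp (jumpSum (K₂.indicator k₂) ε (fun s => X s ω) t) ∂P := by
  obtain ⟨η, hη, hthick⟩ := hdisj.exists_thickenings hK₁ hK₂.isClosed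
  -- The bound `ε` keeps the thickenings off the ball of radius `ε`, as the compact sets have norms
  -- at least `2 * ε`; the bound `η` keeps them disjoint.
  set δ : ℕ → ℝ := fun j => min ε η * (1 / ((j : ℝ) + 1)) with hδ
  have hmin : 0 < min ε η := lt_min hε hη
  have hδpos : ∀ j, 0 < δ j := fun j => by positivity
  have hδle : ∀ j, δ j ≤ min ε η := fun j => by
    refine mul_le_of_le_one_right hmin.le ?_
    rw [div_le_one (by positivity)]
    linarith [Nat.cast_nonneg (α := ℝ) j]
  have hδlim : Tendsto δ atTop (𝓝 0) := by
    simpa [hδ] using (tendsto_one_div_add_atTop_nhds_zero_nat (𝕜 := ℝ)).const_mul (min ε η)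
  set u : Set (EuclideanSpace ℝ (Fin n)) → ℕ → EuclideanSpace ℝ (Fin n) → ℝ := fun K j x =>
    thickenedIndicator (hδpos j) K x with hu
  have huc : ∀ K j, Continuous (u K j) := fun K j =>
    NNReal.continuous_coe.comp (thickenedIndicator (hδpos j) K).continuous
  have hunn : ∀ K j x, 0 ≤ u K j x := fun K j x => NNReal.coe_nonneg _
  have hu0 : ∀ K j x, x ∉ Metric.thickening (δ j) K → u K j x = 0 := fun K j x hx => by
    rw [hu]
    simp only
    rw [thickenedIndicator_zero (hδpos j) K hx, NNReal.coe_zero]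
  have husmall : ∀ K : Set (EuclideanSpace ℝ (Fin n)), (∀ x ∈ K, 2 * ε ≤ ‖x‖) →
      ∀ j x, ‖x‖ < ε → u K j x = 0 := fun K hK j x hx => hu0 K j x fun hmem => by
    obtain ⟨z, hz, hd⟩ := Metric.mem_thickening_iff.1 hmem
    have h1 : ‖z‖ ≤ ‖x‖ + dist x z := by
      rw [dist_eq_norm, ← norm_neg (x - z)]
      simpa using norm_add_le x (-(x - z))
    linarith [hK z hz, hδle j, min_le_left ε η]
  have hulim : ∀ K : Set (EuclideanSpace ℝ (Fin n)), IsCompact K →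
      ∀ (k : EuclideanSpace ℝ (Fin n) → ℂ) x,
      Tendsto (fun j => (u K j x : ℂ) * k x) atTop (𝓝 (K.indicator k x)) := fun K hK k x => by
    have h1 := tendsto_pi_nhds.1
      (thickenedIndicator_tendsto_indicator_closure hδpos hδlim K) x
    rw [hK.isClosed.closure_eq] at h1
    have h2 := ((continuous_ofReal.tendsto _).comp (NNReal.tendsto_coe.2 h1)).mul_const (k x)
    have h3 : (((K.indicator (fun _ => (1 : ℝ≥0)) x : ℝ≥0) : ℝ) : ℂ) * k x = K.indicator k x := by
      by_cases hx : x ∈ K <;> simp [hx]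
    rw [h3] at h2
    exact h2
  have hmul : ∀ K (k : EuclideanSpace ℝ (Fin n) → ℂ), Continuous k → ∀ j,
      Continuous fun x => (u K j x : ℂ) * k x := fun K k hk j =>
    (continuous_ofReal.comp (huc K j)).mul hk
  have hre : ∀ K (k : EuclideanSpace ℝ (Fin n) → ℂ), (∀ x, (k x).re ≤ 0) → ∀ j x,
      ((u K j x : ℂ) * k x).re ≤ 0 := fun K k hk j x => by
    rw [re_ofReal_mul]
    exact mul_nonpos_of_nonneg_of_nonpos (hunn K j x) (hk x)
  refine hX.integral_exp_jumpSum_of_tendsto hc hε t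
    (k₁ := fun j x => (u K₁ j x : ℂ) * k₁ x) (k₂ := fun j x => (u K₂ j x : ℂ) * k₂ x)
    (fun j => (hmul K₁ k₁ hk₁ j).measurable) (fun j => (hmul K₂ k₂ hk₂ j).measurable)
    (hre K₁ k₁ hre₁) (hre K₂ k₂ hre₂)
    (ae_of_all _ fun ω s _ => hulim K₁ hK₁ k₁ _) (ae_of_all _ fun ω s _ => hulim K₂ hK₂ k₂ _)
    fun j => ?_
  refine hX.integral_exp_jumpSum_of_continuous hc hε t (hmul K₁ k₁ hk₁ j) (hmul K₂ k₂ hk₂ j)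
    (fun x hx => by rw [husmall K₁ hK₁ε j x hx, ofReal_zero, zero_mul])
    (fun x hx => by rw [husmall K₂ hK₂ε j x hx, ofReal_zero, zero_mul])
    (hre K₁ k₁ hre₁ j) (hre K₂ k₂ hre₂ j) fun x => ?_
  by_cases hx : x ∈ Metric.thickening (δ j) K₁
  · right
    have hx2 : x ∉ Metric.thickening (δ j) K₂ := fun hx2 =>
      Set.disjoint_left.1 hthick
        (Metric.thickening_mono ((hδle j).trans (min_le_right _ _)) _ hx)
        (Metric.thickening_mono ((hδle j).trans (min_le_right _ _)) _ hx2)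
    rw [hu0 K₂ j x hx2, ofReal_zero, zero_mul]
  · left
    rw [hu0 K₁ j x hx, ofReal_zero, zero_mul]

/-- A finite measure on the space of the jump sizes that charges every set in which a jump of size
at least `ε` up to time `t` lies with positive probability. -/
theorem IsLevyProcess.exists_finite_measure (hX : IsLevyProcess F P X)
    (hc : ∀ ω, IsCadlag fun t => X t ω) (hε : 0 < ε) (t : ℝ≥0) :
    ∃ μ : Measure (EuclideanSpace ℝ (Fin n)), IsFiniteMeasure μ ∧ ∀ A, MeasurableSet A → μ A = 0 →
      ∀ᵐ ω ∂P, ∀ s ∈ bigJumps (fun s => X s ω) ε t, jump (fun s => X s ω) s ∉ A := by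
  have hN : Measurable fun ω => jumpMeasure ε (fun s => X s ω) t :=
    measurable_jumpMeasure hc (fun s _ => hX.measurable s) hε
  have hNA : ∀ A, MeasurableSet A → Measurable fun ω => jumpMeasure ε (fun s => X s ω) t A :=
    fun A hA => (Measure.measurable_coe hA).comp hN
  have hfin := fun ω => (hc ω).isFiniteMeasure_jumpMeasure hε t
  -- This weight makes the averaged jump measure finite without any moment bound on the number of
  -- jumps. It never vanishes, so null sets are not enlarged.
  set w : Ω → ℝ≥0∞ := fun ω => (1 + jumpMeasure ε (fun s => X s ω) t Set.univ)⁻¹ with hw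
  have hwm : Measurable w :=
    (measurable_const.add (hNA _ MeasurableSet.univ)).inv
  refine ⟨(P.withDensity w).bind fun ω => jumpMeasure ε (fun s => X s ω) t, ⟨?_⟩,
    fun A hA hA0 => ?_⟩
  · rw [Measure.bind_apply MeasurableSet.univ hN.aemeasurable,
      lintegral_withDensity_eq_lintegral_mul
      _ hwm (hNA _ MeasurableSet.univ)]
    calc _ ≤ ∫⁻ _, 1 ∂P := by
          refine lintegral_mono fun ω => ?_
          rw [Pi.mul_apply, hw, mul_comm, ← div_eq_mul_inv]
          exact ENNReal.div_le_of_le_mul (by rw [one_mul]; exact le_add_self)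
      _ < ∞ := by simp
  · rw [Measure.bind_apply hA hN.aemeasurable,
      lintegral_eq_zero_iff (hNA A hA)] at hA0
    have hA1 := (ae_withDensity_iff hwm).1 hA0
    filter_upwards [hA1] with ω hω s hs hmem
    have h1 : jumpMeasure ε (fun s => X s ω) t A = 0 :=
      hω (ENNReal.inv_ne_zero.2 (ENNReal.add_ne_top.2 ⟨ENNReal.one_ne_top, measure_ne_top _ _⟩))
    rw [(hc ω).jumpMeasure_apply hε t hA, (hc ω).jumpSum_eq_sum hε, Finset.sum_eq_zero_iff] at h1
    have h2 := h1 s ((Set.Finite.mem_toFinset _).2 hs)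
    rw [Set.indicator_of_mem hmem] at h2
    exact one_ne_zero h2

theorem exists_monotone_isCompact {E : Type*} [TopologicalSpace E] [PolishSpace E]
    [MeasurableSpace E] [BorelSpace E] (μ : Measure E) [IsFiniteMeasure μ] {A : Set E}
    (hA : MeasurableSet A) :
    ∃ K : ℕ → Set E, Monotone K ∧ (∀ j, IsCompact (K j)) ∧ (∀ j, K j ⊆ A) ∧
      μ (A \ ⋃ j, K j) = 0 := by
  have hpos : ∀ j : ℕ, ((j : ℝ≥0∞) + 1)⁻¹ ≠ 0 := fun j =>
    ENNReal.inv_ne_zero.2 (ENNReal.add_ne_top.2 ⟨ENNReal.natCast_ne_top j, ENNReal.one_ne_top⟩)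
  choose K hKA hK hμ using fun j : ℕ => hA.exists_isCompact_sdiff_lt (measure_ne_top μ A) (hpos j)
  refine ⟨Set.accumulate K, Set.monotone_accumulate, isCompact_accumulate hK,
    fun j => Set.iUnion₂_subset fun i _ => hKA i, ?_⟩
  have hlim : Tendsto (fun j : ℕ => ((j : ℝ≥0∞) + 1)⁻¹) atTop (𝓝 0) := by
    have := ENNReal.tendsto_inv_nat_nhds_zero.comp (tendsto_add_atTop_nat 1)
    simpa [Function.comp_def] using this
  refine le_antisymm (ge_of_tendsto' hlim fun j => ?_) zero_le
  refine (measure_mono ?_).trans (hμ j).le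
  rw [Set.iUnion_accumulate]
  exact Set.sdiff_subset_sdiff_right (Set.subset_iUnion K j)

/-- Each set is exhausted from inside by compact sets up to a `μ`-null remainder, which almost
surely contains no jump of size at least `ε` up to time `t`. Hence the compact indicators converge
at every such jump. -/
theorem IsLevyProcess.integral_exp_jumpSum_of_disjoint (hX : IsLevyProcess F P X)
    (hc : ∀ ω, IsCadlag fun t => X t ω) (hε : 0 < ε) (t : ℝ≥0)
    {k₁ k₂ : EuclideanSpace ℝ (Fin n) → ℂ} (hk₁ : Continuous k₁) (hk₂ : Continuous k₂)
    (hre₁ : ∀ x, (k₁ x).re ≤ 0) (hre₂ : ∀ x, (k₂ x).re ≤ 0)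
    {B₁ B₂ : Set (EuclideanSpace ℝ (Fin n))} (hB₁ : MeasurableSet B₁) (hB₂ : MeasurableSet B₂)
    (hB₁ε : ∀ x ∈ B₁, 2 * ε ≤ ‖x‖) (hB₂ε : ∀ x ∈ B₂, 2 * ε ≤ ‖x‖) (hdisj : Disjoint B₁ B₂) :
    ∫ ω, exp (jumpSum (B₁.indicator k₁) ε (fun s => X s ω) t +
        jumpSum (B₂.indicator k₂) ε (fun s => X s ω) t) ∂P =
      (∫ ω, exp (jumpSum (B₁.indicator k₁) ε (fun s => X s ω) t) ∂P) *
        ∫ ω, exp (jumpSum (B₂.indicator k₂) ε (fun s => X s ω) t) ∂P := by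
  obtain ⟨μ, hμ, hae⟩ := hX.exists_finite_measure hc hε t
  obtain ⟨K₁, hmono₁, hK₁, hsub₁, hnull₁⟩ := exists_monotone_isCompact μ hB₁
  obtain ⟨K₂, hmono₂, hK₂, hsub₂, hnull₂⟩ := exists_monotone_isCompact μ hB₂
  have hlim : ∀ (B : Set (EuclideanSpace ℝ (Fin n))) (K : ℕ → Set (EuclideanSpace ℝ (Fin n)))
      (k : EuclideanSpace ℝ (Fin n) → ℂ), MeasurableSet B → Monotone K → (∀ j, IsCompact (K j)) →
      (∀ j, K j ⊆ B) → μ (B \ ⋃ j, K j) = 0 → ∀ᵐ ω ∂P, ∀ s ∈ bigJumps (fun s => X s ω) ε t,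
        Tendsto (fun j => (K j).indicator k (jump (fun s => X s ω) s)) atTop
          (𝓝 (B.indicator k (jump (fun s => X s ω) s))) := by
    intro B K k hB hmono hK hsub hnull
    filter_upwards [hae _ (hB.diff (MeasurableSet.iUnion fun j => (hK j).measurableSet)) hnull]
      with ω hω s hs
    set x := jump (fun s => X s ω) s
    by_cases hx : x ∈ B
    · have hxK : x ∈ ⋃ j, K j := by
        by_contra hne
        exact hω s hs ⟨hx, hne⟩
      obtain ⟨j, hj⟩ := Set.mem_iUnion.1 hxK
      refine tendsto_const_nhds.congr' ?_
      filter_upwards [eventually_ge_atTop j] with i hi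
      rw [Set.indicator_of_mem hx, Set.indicator_of_mem (hmono hi hj)]
    · rw [Set.indicator_of_notMem hx]
      refine tendsto_const_nhds.congr fun i => ?_
      rw [Set.indicator_of_notMem fun h => hx (hsub i h)]
  have hre : ∀ (K : Set (EuclideanSpace ℝ (Fin n))) (k : EuclideanSpace ℝ (Fin n) → ℂ),
      (∀ x, (k x).re ≤ 0) → ∀ x, (K.indicator k x).re ≤ 0 := fun K k hk x => by
    by_cases hx : x ∈ K
    · rw [Set.indicator_of_mem hx]
      exact hk x
    · rw [Set.indicator_of_notMem hx, zero_re]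
  exact hX.integral_exp_jumpSum_of_tendsto hc hε t
    (k₁ := fun j => (K₁ j).indicator k₁) (k₂ := fun j => (K₂ j).indicator k₂)
    (fun j => hk₁.measurable.indicator (hK₁ j).measurableSet)
    (fun j => hk₂.measurable.indicator (hK₂ j).measurableSet)
    (fun j => hre _ _ hre₁) (fun j => hre _ _ hre₂)
    (hlim B₁ K₁ k₁ hB₁ hmono₁ hK₁ hsub₁ hnull₁) (hlim B₂ K₂ k₂ hB₂ hmono₂ hK₂ hsub₂ hnull₂)
    fun j => hX.integral_exp_jumpSum_of_isCompact hc hε t hk₁ hk₂ hre₁ hre₂ (hK₁ j) (hK₂ j)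
      (fun x hx => hB₁ε x (hsub₁ j hx)) (fun x hx => hB₂ε x (hsub₂ j hx))
      (hdisj.mono (hsub₁ j) (hsub₂ j))

theorem IsCadlag.inner_jumpSum_indicator {f : ℝ≥0 → EuclideanSpace ℝ (Fin n)} (hf : IsCadlag f)
    (hε : 0 < ε) (t : ℝ≥0) (B : Set (EuclideanSpace ℝ (Fin n))) (u : EuclideanSpace ℝ (Fin n)) :
    (inner ℝ (jumpSum (B.indicator id) ε f t) u : ℂ) * I =
      jumpSum (B.indicator fun x => (inner ℝ x u : ℂ) * I) ε f t := by
  rw [hf.jumpSum_eq_sum hε, hf.jumpSum_eq_sum hε, sum_inner, ofReal_sum, Finset.sum_mul]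
  refine Finset.sum_congr rfl fun s _ => ?_
  by_cases h : jump f s ∈ B <;> simp [h]

/-- The sums of the jumps in two disjoint sets are independent at each fixed time. -/
theorem IsLevyProcess.indepFun_jumpSum_indicator (hX : IsLevyProcess F P X)
    (hc : ∀ ω, IsCadlag fun t => X t ω) (hε : 0 < ε) (t : ℝ≥0)
    {B₁ B₂ : Set (EuclideanSpace ℝ (Fin n))} (hB₁ : MeasurableSet B₁) (hB₂ : MeasurableSet B₂)
    (hB₁ε : ∀ x ∈ B₁, 2 * ε ≤ ‖x‖) (hB₂ε : ∀ x ∈ B₂, 2 * ε ≤ ‖x‖) (hdisj : Disjoint B₁ B₂) :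
    IndepFun (fun ω => jumpSum (B₁.indicator id) ε (fun s => X s ω) t)
      (fun ω => jumpSum (B₂.indicator id) ε (fun s => X s ω) t) P := by
  have hm₁ := hX.measurable_jumpSum hc (measurable_id.indicator hB₁) hε t
  have hm₂ := hX.measurable_jumpSum hc (measurable_id.indicator hB₂) hε t
  rw [indepFun_iff_charFun_prod hm₁.aemeasurable hm₂.aemeasurable]
  intro u
  have hk : ∀ v : EuclideanSpace ℝ (Fin n), Continuous fun x => (inner ℝ x v : ℂ) * I := fun v =>
    (continuous_ofReal.comp (continuous_id.inner continuous_const)).mul continuous_const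
  have hfac := hX.integral_exp_jumpSum_of_disjoint hc hε t (hk u.ofLp.1) (hk u.ofLp.2)
    (fun x => by simp) (fun x => by simp) hB₁ hB₂ hB₁ε hB₂ε hdisj
  simp_rw [← (hc _).inner_jumpSum_indicator hε] at hfac
  -- A general `E` is needed: it is used for both the factors and their `WithLp` product.
  have hexp : ∀ {E : Type} [NormedAddCommGroup E] [InnerProductSpace ℝ E] [MeasurableSpace E]
      [BorelSpace E] [SecondCountableTopology E] (v : E),
      Measurable fun x : E => exp ((inner ℝ x v : ℂ) * I) := fun v =>
    Continuous.measurable (continuous_exp.comp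
      ((continuous_ofReal.comp (continuous_id.inner continuous_const)).mul continuous_const))
  rw [charFun_apply, charFun_apply, charFun_apply,
    integral_map hm₁.aemeasurable (hexp _).aestronglyMeasurable,
    integral_map hm₂.aemeasurable (hexp _).aestronglyMeasurable,
    integral_map (by fun_prop) (hexp _).aestronglyMeasurable, ← hfac]
  simp [WithLp.prod_inner_apply, add_mul]

end FixedTimeIndependence

end JumpProcesses

/-! ### The theorem on jump processes of disjoint sets. -/

theorem mainTheorem9 {Ω : Type*} {mΩ : MeasurableSpace Ω} (P : Measure Ω) [IsProbabilityMeasure P]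
    (F : Filtration ℝ≥0 mΩ) {n : ℕ} (X : ℝ≥0 → Ω → EuclideanSpace ℝ (Fin n))
    (hX : JumpProcesses.IsLevyProcess F P X)
    (hcadlag : ∀ ω, JumpProcesses.IsCadlag (fun t => X t ω))
    (B₁ B₂ : Set (EuclideanSpace ℝ (Fin n)))
    (hB₁ : MeasurableSet B₁) (hB₂ : MeasurableSet B₂) (hdisj : Disjoint B₁ B₂)
    (h0 : (0 : EuclideanSpace ℝ (Fin n)) ∉ closure B₁ ∪ closure B₂) :
    JumpProcesses.IsLevyProcess F P (JumpProcesses.jumpProcess X B₁) ∧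
    JumpProcesses.IsLevyProcess F P (JumpProcesses.jumpProcess X B₂) ∧
    IndepFun (fun ω t => JumpProcesses.jumpProcess X B₁ t ω)
      (fun ω t => JumpProcesses.jumpProcess X B₂ t ω) P := by
  rw [← closure_union] at h0
  obtain ⟨r, hr, hB⟩ := JumpProcesses.exists_pos_forall_le_norm h0
  -- Truncating at half the distance leaves the room `2 * ε ≤ ‖x‖` needed to thicken compact
  -- subsets.
  have hε : 0 < r / 2 := half_pos hr
  have hB₁r : ∀ x ∈ B₁, 2 * (r / 2) ≤ ‖x‖ := fun x hx => by
    linarith [hB x (Or.inl hx)]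
  have hB₂r : ∀ x ∈ B₂, 2 * (r / 2) ≤ ‖x‖ := fun x hx => by
    linarith [hB x (Or.inr hx)]
  have h₁ : JumpProcesses.jumpProcess X B₁ =
      fun t ω => JumpProcesses.jumpSum (B₁.indicator id) (r / 2) (fun s => X s ω) t := by
    funext t ω
    exact JumpProcesses.jumpProcess_eq_jumpSum (hcadlag ω) hε
      (fun x hx => by linarith [hB₁r x hx]) t
  have h₂ : JumpProcesses.jumpProcess X B₂ =
      fun t ω => JumpProcesses.jumpSum (B₂.indicator id) (r / 2) (fun s => X s ω) t := by
    funext t ω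
    exact JumpProcesses.jumpProcess_eq_jumpSum (hcadlag ω) hε
      (fun x hx => by linarith [hB₂r x hx]) t
  rw [h₁, h₂]
  have hm₁ : Measurable (B₁.indicator (id : EuclideanSpace ℝ (Fin n) → _)) :=
    measurable_id.indicator hB₁
  have hm₂ : Measurable (B₂.indicator (id : EuclideanSpace ℝ (Fin n) → _)) :=
    measurable_id.indicator hB₂
  exact ⟨hX.isLevyProcess_jumpSum hcadlag hm₁ hε, hX.isLevyProcess_jumpSum hcadlag hm₂ hε,
    hX.indepFun_jumpSum_of_forall hcadlag hm₁ hm₂ hε fun s =>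
      hX.indepFun_jumpSum_indicator hcadlag hε s hB₁ hB₂ hB₁r hB₂r hdisj⟩
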